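/- Let $n\ge 2$ be an integer and let $\alpha,\beta>1$ be real. Let $Q\in C^\infty([1,\alpha],\mathbb{R}_{\ge 0})$ with $Q(y)=0$ if and only if $y\in\{1,\alpha\}$. Consider classical solutions $f:[1,\beta]\times[0,\infty)\to[1,\alpha]$ (that is, $f,f_x,f_{xx},f_t$ exist and are continuous on $[1,\beta]\times[0,\infty)$) of $$\frac{\partial f}{\partial t}=Q(f)\Big[\frac{\partial^2 f}{\partial x^2}+(n-1)\frac{1}{x}\frac{\partial f}{\partial x}-(n-1)\frac{f}{x^2}\Big],\qquad f(1,t)=1,\quad f(\beta,t)=\alpha\quad(t\ge 0),$$ whose initial value $f(\cdot,0)$ is strictly increasing on $[1,\beta]$. There is a function $f_\infty:[1,\beta]\to\mathbb{R}$, depending only on $n,\alpha,\beta$ (not on $Q$ or on the initial value), such that for every such solution $f(\cdot,t)\to f_\infty$ uniformly on $[1,\beta]$ as $t\to\infty$. Put $$\tilde f(x)=ax+\frac{b}{x^{n-1}},\qquad a=\frac{\alpha\beta^{n-1}-1}{\beta^n-1},\qquad b=\frac{\beta^n-\alpha\beta^{n-1}}{\beta^n-1}.$$ 1. If $\alpha>\beta$,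 then $f_\infty=\tilde f$ on $[1,\beta]$. 2. If $\alpha<\beta$ and $\frac{\alpha\beta^{n-1}-1}{\beta^n-1}>\frac{n-1}{n}$, then $f_\infty=\tilde f$ on $[1,\beta]$. 3. If $\alpha<\beta$ and $\frac{\alpha\beta^{n-1}-1}{\beta^n-1}=\frac{n-1}{n}$, then $f_\infty=\tilde f$ on $[1,\beta]$. 4. If $\alpha<\beta$ and $\frac{\alpha\beta^{n-1}-1}{\beta^n-1}<\frac{n-1}{n}$, let $\lambda$ be the infimum of all $\lambda'\in[1,\beta]$ for which there is a solution $g\ge 1$ on $[\lambda',\beta]$ of $$g''+(n-1)\frac{g'}{x}-(n-1)\frac{g}{x^2}=0$$ with $g(\lambda')=1$ and $g(\beta)=\alpha$. This infimum is attained, $1<\lambda<\beta$, and the unique solution $g$ of this equation on $[\lambda,\beta]$ with $g(\lambda)=1$, $g(\beta)=\alpha$ satisfies $g'(\lambda)=0$. Then $f_\infty=1$ on $[1,\lambda]$ and $f_\infty=g$ on $[\lambda,\beta]$. -/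

import Mathlib

open Set Filter Topology
open scoped ContDiff

/-- The coefficient `Q ∈ C^∞([1,α], ℝ≥0)`, vanishing exactly at the two endpoints. -/
structure IsDegenerateCoefficient (α : ℝ) (Q : ℝ → ℝ) : Prop where
  smooth : ContDiffOn ℝ ∞ Q (Icc 1 α)
  nonneg : ∀ y ∈ Icc 1 α, 0 ≤ Q y
  zero_iff : ∀ y ∈ Icc 1 α, (Q y = 0 ↔ y = 1 ∨ y = α)

/-- `f x t` is a classical solution on `[1,β] × [0,∞)` of
`∂f/∂t = Q(f) [f'' + (n-1) f'/x - (n-1) f/x²]`, `f(1,t) = 1`, `f(β,t) = α`, with values in the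
domain `[1,α]` of `Q`: the derivatives `f_x`, `f_xx`, `f_t` exist and, like `f`, are continuous up
to the boundary (one-sided derivatives at the boundary). -/
structure IsClassicalSolution (n : ℕ) (α β : ℝ) (Q : ℝ → ℝ) (f : ℝ → ℝ → ℝ) : Prop where
  range : ∀ x ∈ Icc 1 β, ∀ t ∈ Ici (0 : ℝ), f x t ∈ Icc 1 α
  left : ∀ t ∈ Ici (0 : ℝ), f 1 t = 1
  right : ∀ t ∈ Ici (0 : ℝ), f β t = α
  cont : ContinuousOn (fun p : ℝ × ℝ => f p.1 p.2) (Icc 1 β ×ˢ Ici 0)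
  equation : ∃ fx fxx ft : ℝ → ℝ → ℝ,
    ContinuousOn (fun p : ℝ × ℝ => fx p.1 p.2) (Icc 1 β ×ˢ Ici 0) ∧
    ContinuousOn (fun p : ℝ × ℝ => fxx p.1 p.2) (Icc 1 β ×ˢ Ici 0) ∧
    ContinuousOn (fun p : ℝ × ℝ => ft p.1 p.2) (Icc 1 β ×ˢ Ici 0) ∧
    ∀ x ∈ Icc 1 β, ∀ t ∈ Ici (0 : ℝ),
      HasDerivWithinAt (fun y => f y t) (fx x t) (Icc 1 β) x ∧
      HasDerivWithinAt (fun y => fx y t) (fxx x t) (Icc 1 β) x ∧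
      HasDerivWithinAt (fun s => f x s) (ft x t) (Ici 0) t ∧
      ft x t = Q (f x t) *
        (fxx x t + ((n : ℝ) - 1) * fx x t / x - ((n : ℝ) - 1) * f x t / x ^ 2)

/-- `g` solves `g'' + (n-1) g'/x - (n-1) g/x² = 0` on the interval `[l,β]`. -/
def SolvesODE (n : ℕ) (l β : ℝ) (g : ℝ → ℝ) : Prop :=
  ∃ g₁ g₂ : ℝ → ℝ, ∀ x ∈ Icc l β,
    HasDerivWithinAt g (g₁ x) (Icc l β) x ∧
    HasDerivWithinAt g₁ (g₂ x) (Icc l β) x ∧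
    g₂ x + ((n : ℝ) - 1) * g₁ x / x - ((n : ℝ) - 1) * g x / x ^ 2 = 0

/-- The solution `ax + b/x^(n-1)` of the ODE with boundary values `1` at `1` and `α` at `β`. -/
noncomputable def odeProfile (n : ℕ) (α β : ℝ) (x : ℝ) : ℝ :=
  (α * β ^ (n - 1) - 1) / (β ^ n - 1) * x +
    (β ^ n - α * β ^ (n - 1)) / (β ^ n - 1) / x ^ (n - 1)

/-- The points `l ∈ [1,β]` for which some solution `g ≥ 1` of the ODE on `[l,β]` has `g(l) = 1`
and `g(β) = α`. -/
def admissiblePoints (n : ℕ) (α β : ℝ) : Set ℝ :=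
  {l | l ∈ Icc 1 β ∧ ∃ g : ℝ → ℝ, SolvesODE n l β g ∧ g l = 1 ∧ g β = α ∧
    ∀ x ∈ Icc l β, 1 ≤ g x}

/-! ### One-variable calculus -/

/-! Write `k = n - 1` and `L v = v'' + k v'/x - k v/x²`. The limit `F` solves the obstacle problem
for `L` with obstacle `1`: it equals `1` on `[1,l]` and `a x + b/x^k` beyond `l`, with a `C¹`
junction when `l > 1`. If the solution through both boundary values has nonnegative slope at `1`,
which means `a ≥ k/(k+1)`, then `l = 1`. Otherwise `l` is the point at which a solution tangent to
the obstacle ends at `α`.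

Convergence comes from an entropy that absorbs the degenerate coefficient. Dividing `v_t = R(v) L v`
by `R(v)` and multiplying by `(v - F - c)₊²` gives on the left the time derivative of a potential in
`v` at fixed `x`. Integrated against `x^k dx`, the right side is at most `-c k ∫ x^k (v - F -
c)₊²/x²`: integration by parts and the weak supersolution property of `F` dispose of the other
terms, and the zero-order term of `L` turns the shift `c` into strict dissipation
(`integral_sq_pos_part_mul_radialOp_le`). The potential is finite because it only sees values above
`F + c`, away from the lower zero of `R`, and because interior values do not reach the upper zero in
finite time (`lt_of_deriv_eq_mul`).

Two consequences follow. The barrier `F + c` is never crossed once the solution lies below it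
(`le_barrier_of_le`), and the total dissipation over all time is finite (`exists_dissipation_le`).
If `F + ε` were exceeded somewhere at arbitrarily late times, it would be exceeded at every time.
Monotonicity of `f` in `x`, preserved by the maximum principle (`IsClassicalSolution.monotoneOn`),
spreads the excess over an interval of fixed length, so the dissipation rate stays bounded below, a
contradiction (`eventually_le_barrier`).

The lower bound is the same argument for `-f` and `-F`. On the contact set `-F` has the wrong sign
of `L`, but there `f ≥ 1 = F`, so the test function vanishes. -/

theorem hasDerivAt_sq_max_zero (y : ℝ) :
    HasDerivAt (fun z : ℝ => max z 0 ^ 2) (2 * max y 0) y := by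
  rcases lt_trichotomy y 0 with hy | rfl | hy
  · have h : (fun z : ℝ => max z 0 ^ 2) =ᶠ[𝓝 y] fun _ => 0 := by
      filter_upwards [Iio_mem_nhds hy] with z hz
      simp [max_eq_right (mem_Iio.1 hz).le]
    simpa [max_eq_right hy.le] using (hasDerivAt_const y (0 : ℝ)).congr_of_eventuallyEq h
  · have h : (fun z : ℝ => max z 0 ^ 2) =O[𝓝 0] fun z => ‖z - 0‖ ^ 2 := by
      refine Asymptotics.IsBigO.of_bound 1 (Eventually.of_forall fun z => ?_)
      rw [sub_zero, one_mul, norm_pow, norm_pow, norm_norm]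
      gcongr
      rcases le_total z 0 with hz | hz <;> simp [hz]
    simpa using (h.hasFDerivAt one_lt_two).hasDerivAt
  · have h : (fun z : ℝ => max z 0 ^ 2) =ᶠ[𝓝 y] fun z => z ^ 2 := by
      filter_upwards [Ioi_mem_nhds hy] with z hz
      simp [max_eq_left (mem_Ioi.1 hz).le]
    simpa [max_eq_left hy.le] using (hasDerivAt_pow 2 y).congr_of_eventuallyEq h

/-- The second derivative is nonnegative at a local minimum. -/
theorem IsLocalMin.second_deriv_nonneg {f f' : ℝ → ℝ} {f'' x : ℝ} (hmin : IsLocalMin f x)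
    (hf : ∀ᶠ y in 𝓝 x, HasDerivAt f (f' y) y) (hf' : HasDerivAt f' f'' x) : 0 ≤ f'' := by
  by_contra! hneg
  have h0 : f' x = 0 := hmin.hasDerivAt_eq_zero hf.self_of_nhds
  have hlt : ∀ᶠ y in 𝓝[>] x, f' y < 0 := by
    have h := (hasDerivAt_iff_tendsto_slope.1 hf').mono_left
      (nhdsWithin_mono x (fun y (hy : x < y) => hy.ne'))
    filter_upwards [h.eventually (gt_mem_nhds hneg), self_mem_nhdsWithin] with y hy hxy
    rw [slope_def_field, h0, sub_zero] at hy
    have hpos : 0 < y - x := sub_pos.2 hxy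
    by_contra! hge
    exact absurd hy (not_lt.2 (div_nonneg hge hpos.le))
  obtain ⟨z, hxz, hz⟩ := mem_nhdsGT_iff_exists_Ioo_subset.1
    (hlt.and ((hf.and hmin).filter_mono nhdsWithin_le_nhds))
  have hxz : x < z := hxz
  set y := (x + z) / 2 with hy
  have hxy : x < y := by linarith
  have hyz : y < z := by linarith
  obtain ⟨c, hc, hceq⟩ := exists_hasDerivAt_eq_slope f f' hxy
    (fun w hw => by
      rcases hw.1.eq_or_lt with rfl | hw1
      · exact hf.self_of_nhds.continuousAt.continuousWithinAt
      · exact (hz ⟨hw1, hw.2.trans_lt hyz⟩).2.1.continuousAt.continuousWithinAt)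
    (fun w hw => (hz ⟨hw.1, hw.2.trans hyz⟩).2.1)
  have h1 : f' c < 0 := (hz ⟨hc.1, hc.2.trans hyz⟩).1
  have h2 : f x ≤ f y := (hz ⟨hxy, hyz⟩).2.2
  rw [hceq] at h1
  exact absurd h1 (not_lt.2 (div_nonneg (by linarith) (by linarith)))

/-- The derivative is nonpositive at a point that minimizes the function over an interval ending
there. -/
theorem HasDerivAt.nonpos_of_left_min {f : ℝ → ℝ} {f' a b : ℝ} (hab : a < b)
    (hf : HasDerivAt f f' b) (hmin : ∀ t ∈ Icc a b, f b ≤ f t) : f' ≤ 0 := by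
  have h : Tendsto (slope f b) (𝓝[<] b) (𝓝 f') := (hasDerivAt_iff_tendsto_slope.1 hf).mono_left
    (nhdsWithin_mono b (fun y (hy : y < b) => hy.ne))
  refine le_of_tendsto h ?_
  filter_upwards [Ioo_mem_nhdsLT hab] with t ht
  rw [slope_def_field]
  exact div_nonpos_of_nonneg_of_nonpos (by linarith [hmin t ⟨ht.1.le, ht.2.le⟩])
    (by linarith [ht.2])

/-- A trajectory of `y' = R(y) ℓ` does not reach a zero `B` of `R` in finite time. -/
theorem lt_of_deriv_eq_mul {R y ℓ : ℝ → ℝ} {B C : ℝ} (hℓ : ContinuousOn ℓ (Ici 0))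
    (hy : ∀ t ∈ Ici (0 : ℝ), HasDerivWithinAt y (R (y t) * ℓ t) (Ici 0) t)
    (hR0 : ∀ t ∈ Ici (0 : ℝ), 0 ≤ R (y t)) (hR : ∀ t ∈ Ici (0 : ℝ), R (y t) ≤ C * (B - y t))
    (h0 : y 0 < B) {T : ℝ} (hT : 0 ≤ T) : y T < B := by
  obtain ⟨K, hK⟩ := isCompact_Icc.exists_bound_of_continuousOn
    (hℓ.mono (Icc_subset_Ici_self : Icc 0 T ⊆ Ici 0))
  have hK0 : 0 ≤ K := (norm_nonneg _).trans (hK 0 ⟨le_rfl, hT⟩)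
  -- Gronwall: `y' = R(y) ℓ ≤ C K (B - y)`, so the integrating factor makes `B - y` nondecreasing.
  have hmono : MonotoneOn (fun t => Real.exp (C * K * t) * (B - y t)) (Icc 0 T) := by
    refine monotoneOn_of_hasDerivWithinAt_nonneg (convex_Icc 0 T)
      (f' := fun t => Real.exp (C * K * t) * (C * K * (B - y t) - R (y t) * ℓ t)) ?_ ?_ ?_
    · have hyc : ContinuousOn y (Icc 0 T) := fun t ht =>
        ((hy t ht.1).continuousWithinAt).mono Icc_subset_Ici_self
      fun_prop
    · intro t ht
      rw [interior_Icc] at ht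
      have hd := (hy t ht.1.le).hasDerivAt (Ici_mem_nhds ht.1)
      have he : HasDerivAt (fun t => Real.exp (C * K * t)) (Real.exp (C * K * t) * (C * K)) t := by
        simpa using ((hasDerivAt_id t).const_mul (C * K)).exp
      refine ((he.mul (hd.const_sub B)).congr_deriv ?_).hasDerivWithinAt
      ring
    · intro t ht
      rw [interior_Icc] at ht
      have h1 := hK t ⟨ht.1.le, ht.2.le⟩
      have h2 : ℓ t ≤ K := (le_abs_self _).trans h1
      have h3 := mul_le_mul_of_nonneg_left h2 (hR0 t ht.1.le)
      have h4 := mul_le_mul_of_nonneg_right (hR t ht.1.le) hK0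
      exact mul_nonneg (Real.exp_pos _).le (by linarith)
  have h := hmono ⟨le_rfl, hT⟩ ⟨hT, le_rfl⟩ hT
  have h' : 0 < Real.exp (C * K * T) * (B - y T) := by
    refine lt_of_lt_of_le ?_ h
    simpa using h0
  linarith [pos_of_mul_pos_right h' (Real.exp_pos _).le]

/-! ### Monotonicity in space -/

/-- Solutions with nondecreasing initial value stay nondecreasing in space. -/
theorem IsClassicalSolution.monotoneOn {n : ℕ} (hn : 2 ≤ n) {α β : ℝ} {Q : ℝ → ℝ} {f : ℝ → ℝ → ℝ}
    (hQ : IsDegenerateCoefficient α Q) (hf : IsClassicalSolution n α β Q f)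
    (h0 : MonotoneOn (fun x => f x 0) (Icc 1 β)) {T : ℝ} (hT : 0 ≤ T) :
    MonotoneOn (fun x => f x T) (Icc 1 β) := by
  obtain ⟨fx, fxx, ft, -, -, -, hd⟩ := hf.equation
  obtain ⟨C, hC⟩ : ∃ C, LipschitzOnWith C (fun s => Q s * s) (Icc 1 α) :=
    (hQ.smooth.mul contDiffOn_id).exists_lipschitzOnWith (by simp) (convex_Icc _ _) isCompact_Icc
  have hN : (1 : ℝ) ≤ (n : ℝ) - 1 := by
    have : (2 : ℝ) ≤ n := by exact_mod_cast hn
    linarith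
  set N : ℝ := (n : ℝ) - 1 with hNdef
  -- `N * C` absorbs the zero-order term, with `C` a Lipschitz constant of `s ↦ Q s * s`; the extra
  -- `1` makes the final inequality strict.
  set K : ℝ := N * C + 1 with hK
  set S : Set (ℝ × ℝ × ℝ) :=
    (Icc 1 β ×ˢ Icc 1 β ×ˢ Icc 0 T) ∩ {p | p.1 ≤ p.2.1} with hS
  have hScomp : IsCompact S := (isCompact_Icc.prod (isCompact_Icc.prod isCompact_Icc)).inter_right
    (isClosed_le continuous_fst (continuous_fst.comp continuous_snd))
  intro x hx y hy hxy
  by_contra! hlt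
  -- Doubling of variables: a negative minimum of this weighted difference over `p ≤ q` must lie at
  -- `1 < p < q < β` and `t > 0`, where both spatial slopes vanish and the second derivatives have
  -- opposite signs.
  set m : ℝ × ℝ × ℝ → ℝ := fun p => Real.exp (-K * p.2.2) * (f p.2.1 p.2.2 - f p.1 p.2.2) with hm
  have hmc : ContinuousOn m S := by
    have h1 : ContinuousOn (fun p : ℝ × ℝ × ℝ => f p.2.1 p.2.2) S :=
      hf.cont.comp (f := fun p : ℝ × ℝ × ℝ => (p.2.1, p.2.2)) (by fun_prop)
        fun p hp => ⟨hp.1.2.1, hp.1.2.2.1⟩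
    have h2 : ContinuousOn (fun p : ℝ × ℝ × ℝ => f p.1 p.2.2) S :=
      hf.cont.comp (f := fun p : ℝ × ℝ × ℝ => (p.1, p.2.2)) (by fun_prop)
        fun p hp => ⟨hp.1.1, hp.1.2.2.1⟩
    exact (Continuous.continuousOn (by fun_prop)).mul (h1.sub h2)
  obtain ⟨⟨p, q, t⟩, ⟨⟨hp, hq, ht⟩, hpq⟩, hmin⟩ := hScomp.exists_isMinOn
    ⟨(x, y, T), ⟨hx, hy, hT, le_rfl⟩, hxy⟩ hmc
  simp only at hp hq ht hpq
  have hpq : p ≤ q := hpq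
  have hmin' : ∀ p' ∈ Icc 1 β, ∀ q' ∈ Icc 1 β, ∀ t' ∈ Icc 0 T, p' ≤ q' →
      m (p, q, t) ≤ m (p', q', t') := fun p' hp' q' hq' t' ht' h =>
    hmin (a := (p', q', t')) ⟨⟨hp', hq', ht'⟩, h⟩
  have hneg : f q t - f p t < 0 := by
    have h1 := hmin' x hx y hy T ⟨hT, le_rfl⟩ hxy
    have h2 : m (x, y, T) < 0 := mul_neg_of_pos_of_neg (Real.exp_pos _) (by simpa using hlt)
    by_contra! hge
    exact absurd (h1.trans_lt h2) (not_lt.2 (mul_nonneg (Real.exp_pos _).le hge))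
  have ht0 : 0 < t := by
    rcases ht.1.eq_or_lt with h | h
    · subst h
      have := h0 hp hq hpq
      simp only at this
      linarith
    · exact h
  have hp1 : 1 < p := by
    rcases hp.1.eq_or_lt with h | h
    · subst h
      linarith [hf.left t ht.1, (hf.range q hq t ht.1).1]
    · exact h
  have hqβ : q < β := by
    rcases hq.2.eq_or_lt with h | h
    · subst h
      linarith [hf.right t ht.1, (hf.range p hp t ht.1).2]
    · exact h
  have hpq' : p < q := by
    rcases hpq.eq_or_lt with h | h
    · subst h; linarith
    · exact h
  have hfix : ∀ p' ∈ Icc 1 β, ∀ q' ∈ Icc 1 β, p' ≤ q' → f q t - f p t ≤ f q' t - f p' t :=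
    fun p' hp' q' hq' h => le_of_mul_le_mul_left (hmin' p' hp' q' hq' t ht h) (Real.exp_pos _)
  have hnq : Ioo p β ∈ 𝓝 q := Ioo_mem_nhds hpq' hqβ
  have hnp : Ioo 1 q ∈ 𝓝 p := Ioo_mem_nhds hp1 hpq'
  have hqmin : IsLocalMin (fun z => f z t) q := by
    filter_upwards [hnq] with z hz
    linarith [hfix p hp z ⟨hp.1.trans hz.1.le, hz.2.le⟩ hz.1.le]
  have hpmin : IsLocalMin (fun z => -f z t) p := by
    filter_upwards [hnp] with z hz
    linarith [hfix z ⟨hz.1.le, hz.2.le.trans hq.2⟩ q hq hz.2.le]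
  have hIcc : ∀ z ∈ Ioo 1 β, Icc 1 β ∈ 𝓝 z := fun z hz => Icc_mem_nhds hz.1 hz.2
  have hqI : q ∈ Ioo 1 β := ⟨hp1.trans hpq', hqβ⟩
  have hpI : p ∈ Ioo 1 β := ⟨hp1, hpq'.trans hqβ⟩
  have hdx : ∀ z ∈ Ioo 1 β, HasDerivAt (fun z => f z t) (fx z t) z := fun z hz =>
    (hd z ⟨hz.1.le, hz.2.le⟩ t ht.1).1.hasDerivAt (hIcc z hz)
  have hdxx : ∀ z ∈ Ioo 1 β, HasDerivAt (fun z => fx z t) (fxx z t) z := fun z hz =>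
    (hd z ⟨hz.1.le, hz.2.le⟩ t ht.1).2.1.hasDerivAt (hIcc z hz)
  have hq1 : fx q t = 0 := hqmin.hasDerivAt_eq_zero (hdx q hqI)
  have hp1' : fx p t = 0 := by
    simpa using hpmin.hasDerivAt_eq_zero (hdx p hpI).neg
  have hq2 : 0 ≤ fxx q t := hqmin.second_deriv_nonneg
    (by filter_upwards [Ioo_mem_nhds hqI.1 hqI.2] with z hz using hdx z hz) (hdxx q hqI)
  have hp2 : 0 ≤ -fxx p t := hpmin.second_deriv_nonneg
    (by filter_upwards [Ioo_mem_nhds hpI.1 hpI.2] with z hz using (hdx z hz).neg) (hdxx p hpI).neg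
  have htime : ft q t - ft p t - K * (f q t - f p t) ≤ 0 := by
    have h1 := (hd q hq t ht.1).2.2.1.hasDerivAt (Ici_mem_nhds ht0)
    have h2 := (hd p hp t ht.1).2.2.1.hasDerivAt (Ici_mem_nhds ht0)
    have he : HasDerivAt (fun t => Real.exp (-K * t)) (Real.exp (-K * t) * (-K)) t := by
      simpa using ((hasDerivAt_id t).const_mul (-K)).exp
    have h3 := (he.mul (h1.sub h2)).nonpos_of_left_min ht0 (fun t' ht' =>
      hmin' p hp q hq t' ⟨ht'.1, ht'.2.trans ht.2⟩ hpq)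
    have h4 : Real.exp (-K * t) * (ft q t - ft p t - K * (f q t - f p t)) ≤ 0 := by
      refine le_of_eq_of_le ?_ h3
      simp only [Pi.sub_apply]
      ring
    exact nonpos_of_mul_nonpos_right h4 (Real.exp_pos _)
  have hrp := hf.range p hp t ht.1
  have hrq := hf.range q hq t ht.1
  have hp0 : 0 < p := by linarith
  have hq0 : 0 < q := by linarith
  -- Replacing `q²` by the smaller `p²` gives both zero-order terms the same denominator, so that
  -- only the Lipschitz bound is needed to compare them.
  have eq1 : ft q t ≥ -N * (Q (f q t) * f q t / p ^ 2) := by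
    rw [(hd q hq t ht.1).2.2.2, hq1]
    have h1 : Q (f q t) * f q t / q ^ 2 ≤ Q (f q t) * f q t / p ^ 2 :=
      div_le_div_of_nonneg_left (mul_nonneg (hQ.nonneg _ hrq) (by linarith [hrq.1])) (by positivity)
        (pow_le_pow_left₀ hp0.le hpq 2)
    have h2 := mul_nonneg (hQ.nonneg _ hrq) hq2
    have h3 := mul_le_mul_of_nonneg_left h1 (by linarith : 0 ≤ N)
    calc Q (f q t) * (fxx q t + N * 0 / q - N * f q t / q ^ 2)
        = Q (f q t) * fxx q t - N * (Q (f q t) * f q t / q ^ 2) := by ring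
      _ ≥ _ := by linarith
  have eq2 : ft p t ≤ -N * (Q (f p t) * f p t / p ^ 2) := by
    rw [(hd p hp t ht.1).2.2.2, hp1']
    have h2 := mul_nonneg (hQ.nonneg _ hrp) hp2
    calc Q (f p t) * (fxx p t + N * 0 / p - N * f p t / p ^ 2)
        = -(Q (f p t) * -fxx p t) - N * (Q (f p t) * f p t / p ^ 2) := by ring
      _ ≤ _ := by linarith
  have hlip : Q (f q t) * f q t - Q (f p t) * f p t ≤ C * (f p t - f q t) := by
    have h1 := hC.dist_le_mul _ hrq _ hrp
    rw [Real.dist_eq, Real.dist_eq, abs_sub_comm (f q t), abs_of_pos (by linarith : 0 < f p t - f q t)]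
      at h1
    exact (le_abs_self _).trans h1
  have hlip' : (Q (f q t) * f q t - Q (f p t) * f p t) / p ^ 2 ≤ C * (f p t - f q t) := by
    refine (div_le_div_of_nonneg_right hlip (by positivity)).trans (div_le_self ?_ ?_)
    · exact mul_nonneg C.2 (by linarith)
    · exact one_le_pow₀ hp.1
  have h5 := mul_le_mul_of_nonneg_left hlip' (by linarith : 0 ≤ N)
  rw [sub_div] at h5
  have h6 : K * (f q t - f p t) = -(N * (C * (f p t - f q t))) - (f p t - f q t) := by
    rw [hK]; ring
  linarith

/-! ### The radial operator and its weak supersolutions -/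

/-- The expression `v'' + k v'/x - k v/x²`. -/
noncomputable def radialOp (k : ℕ) (x v v' v'' : ℝ) : ℝ := v'' + k * v' / x - k * v / x ^ 2

/-- `F`, with derivative `F'`, is a supersolution of the radial operator in the weak sense, tested
against nonnegative `C¹` functions that vanish at the endpoints and where `B ≤ F`. -/
def IsWeakSupersolution (k : ℕ) (β B : ℝ) (F F' : ℝ → ℝ) : Prop :=
  ∀ q q' : ℝ → ℝ, (∀ x ∈ Icc 1 β, HasDerivWithinAt q (q' x) (Icc 1 β) x) →
    ContinuousOn q' (Icc 1 β) → (∀ x ∈ Icc 1 β, 0 ≤ q x) → q 1 = 0 → q β = 0 →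
    (∀ x ∈ Icc 1 β, B ≤ F x → q x = 0) →
    0 ≤ ∫ x in 1..β, x ^ k * (q' x * F' x + k * q x * F x / x ^ 2)

theorem hasDerivAt_pow_of_ne_zero (k : ℕ) {x : ℝ} (hx : x ≠ 0) :
    HasDerivAt (fun x : ℝ => x ^ k) (k * x ^ k / x) x := by
  refine (hasDerivAt_pow k x).congr_deriv ?_
  rcases k with _ | k
  · simp
  · rw [Nat.add_sub_cancel, pow_succ]
    field_simp

/-- Testing the radial operator against the squared positive part of `v - F - c`. -/
theorem integral_sq_pos_part_mul_radialOp_le {k : ℕ} {β B c : ℝ} (hβ : 1 < β) (hc : 0 < c)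
    {v v' v'' F F' : ℝ → ℝ}
    (hv : ∀ x ∈ Icc 1 β, HasDerivWithinAt v (v' x) (Icc 1 β) x)
    (hv' : ∀ x ∈ Icc 1 β, HasDerivWithinAt v' (v'' x) (Icc 1 β) x)
    (hv'' : ContinuousOn v'' (Icc 1 β))
    (hF : ∀ x ∈ Icc 1 β, HasDerivWithinAt F (F' x) (Icc 1 β) x)
    (hF' : ContinuousOn F' (Icc 1 β))
    (hvB : ∀ x ∈ Icc 1 β, v x ≤ B) (h1 : v 1 ≤ F 1) (h2 : v β ≤ F β)
    (hweak : IsWeakSupersolution k β B F F') :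
    ∫ x in 1..β, x ^ k * (max (v x - F x - c) 0 ^ 2 * radialOp k x (v x) (v' x) (v'' x)) ≤
      -(c * k * ∫ x in 1..β, x ^ k * (max (v x - F x - c) 0 ^ 2 / x ^ 2)) := by
  have hvc : ContinuousOn v (Icc 1 β) := fun x hx => (hv x hx).continuousWithinAt
  have hv'c : ContinuousOn v' (Icc 1 β) := fun x hx => (hv' x hx).continuousWithinAt
  have hFc : ContinuousOn F (Icc 1 β) := fun x hx => (hF x hx).continuousWithinAt
  have hpos : ∀ x ∈ Icc 1 β, 0 < x := fun x hx => by linarith [hx.1]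
  have hx2 : ∀ x ∈ Icc 1 β, x ^ 2 ≠ 0 := fun x hx => (pow_pos (hpos x hx) 2).ne'
  have hx1 : ∀ x ∈ Icc 1 β, x ≠ 0 := fun x hx => (hpos x hx).ne'
  set q : ℝ → ℝ := fun x => max (v x - F x - c) 0 ^ 2 with hq
  set q' : ℝ → ℝ := fun x => 2 * max (v x - F x - c) 0 * (v' x - F' x) with hq'
  have hqd : ∀ x ∈ Icc 1 β, HasDerivWithinAt q (q' x) (Icc 1 β) x := fun x hx => by
    have hu : HasDerivWithinAt (fun x => v x - F x - c) (v' x - F' x) (Icc 1 β) x :=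
      ((hv x hx).sub (hF x hx)).sub_const c
    exact (hasDerivAt_sq_max_zero (v x - F x - c)).comp_hasDerivWithinAt x hu
  have hqc : ContinuousOn q (Icc 1 β) := fun x hx => (hqd x hx).continuousWithinAt
  have hq'c : ContinuousOn q' (Icc 1 β) := by rw [hq']; fun_prop
  have hq1 : q 1 = 0 := by
    simp only [hq]
    rw [max_eq_right (by linarith)]
    simp
  have hqβ : q β = 0 := by
    simp only [hq]
    rw [max_eq_right (by linarith)]
    simp
  have hw := hweak q q' hqd hq'c (fun x _ => sq_nonneg _) hq1 hqβ (fun x hx hBF => by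
    simp only [hq]
    rw [max_eq_right (by linarith [hvB x hx])]
    simp)
  have hII : ∀ {g : ℝ → ℝ}, ContinuousOn g (Icc 1 β) →
      IntervalIntegrable g MeasureTheory.volume 1 β := fun hg =>
    hg.intervalIntegrable_of_Icc hβ.le
  have hmulc : ContinuousOn (fun x => k * x ^ k / x * v' x + x ^ k * v'' x) (Icc 1 β) := by
    fun_prop (disch := assumption)
  -- The operator in divergence form is `x^k L v = (x^k v')' - k x^k v/x²`.
  have hparts := intervalIntegral.integral_mul_deriv_eq_deriv_mul_of_hasDerivWithinAt
    (u := q) (u' := q') (v := fun x => x ^ k * v' x)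
    (v' := fun x => k * x ^ k / x * v' x + x ^ k * v'' x) (a := 1) (b := β)
    (by rwa [uIcc_of_le hβ.le])
    (by
      rw [uIcc_of_le hβ.le]
      exact fun x hx =>
        (hasDerivAt_pow_of_ne_zero k (hx1 x hx)).hasDerivWithinAt.mul (hv' x hx))
    (hII hq'c) (hII hmulc)
  rw [hq1, hqβ, zero_mul, zero_mul, sub_zero, zero_sub] at hparts
  have hc1 : ContinuousOn (fun x => x ^ k * (q x / x ^ 2)) (Icc 1 β) := by
    fun_prop (disch := assumption)
  have hc2 : ContinuousOn (fun x => x ^ k * (q' x * F' x + k * q x * F x / x ^ 2)) (Icc 1 β) := by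
    fun_prop (disch := assumption)
  have hc3 : ContinuousOn (fun x => q' x * (x ^ k * v' x)) (Icc 1 β) := by
    fun_prop (disch := assumption)
  have hc4 : ContinuousOn (fun x => x ^ k * (k * q x * v x / x ^ 2)) (Icc 1 β) := by
    fun_prop (disch := assumption)
  have hc5 : ContinuousOn (fun x => q x * (k * x ^ k / x * v' x + x ^ k * v'' x)) (Icc 1 β) :=
    hqc.mul hmulc
  have hc6 : ContinuousOn (fun x => c * k * (x ^ k * (q x / x ^ 2))) (Icc 1 β) :=
    continuousOn_const.mul hc1
  have e1 : ∫ x in 1..β, x ^ k * (q x * radialOp k x (v x) (v' x) (v'' x)) =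
      (∫ x in 1..β, q x * (k * x ^ k / x * v' x + x ^ k * v'' x)) -
        ∫ x in 1..β, x ^ k * (k * q x * v x / x ^ 2) := by
    rw [← intervalIntegral.integral_sub (hII hc5) (hII hc4)]
    refine intervalIntegral.integral_congr fun x _ => ?_
    simp only [radialOp]
    ring
  -- The integrands differ by `x^k (2 w₊ (v' - F')² + k w₊² w / x²) ≥ 0` with `w = v - F - c`;
  -- writing `v - F = w + c` produces the dissipation term.
  have e2 : (∫ x in 1..β, x ^ k * (q' x * F' x + k * q x * F x / x ^ 2)) +
      c * k * (∫ x in 1..β, x ^ k * (q x / x ^ 2)) ≤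
      (∫ x in 1..β, q' x * (x ^ k * v' x)) + ∫ x in 1..β, x ^ k * (k * q x * v x / x ^ 2) := by
    rw [← intervalIntegral.integral_const_mul,
      ← intervalIntegral.integral_add (hII hc2) (hII hc6),
      ← intervalIntegral.integral_add (hII hc3) (hII hc4)]
    refine intervalIntegral.integral_mono_on hβ.le
      (hII (hc2.add hc6)) (hII (hc3.add hc4)) fun x hx => ?_
    have hm : 0 ≤ max (v x - F x - c) 0 := le_max_right _ _
    have hxk : 0 < x ^ k := pow_pos (hpos x hx) k
    have i1 : 0 ≤ 2 * max (v x - F x - c) 0 * (v' x - F' x) ^ 2 := by positivity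
    have i2 : 0 ≤ max (v x - F x - c) 0 ^ 2 * (v x - F x - c) := by
      rcases le_total (v x - F x - c) 0 with h | h
      · simp [max_eq_right h]
      · exact mul_nonneg (sq_nonneg _) h
    have i3 : 0 ≤ x ^ k * (k * (max (v x - F x - c) 0 ^ 2 * (v x - F x - c)) / x ^ 2) := by
      have := hpos x hx
      positivity
    have i4 := mul_nonneg hxk.le i1
    rw [← sub_nonneg]
    refine (add_nonneg i4 i3).trans_eq ?_
    simp only [hq, hq']
    ring
  rw [e1]
  linarith

/-! ### The potential in time -/

/-- The primitive of `(r - m)₊² / R(r)` that vanishes at `m`. -/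
noncomputable def truncatedPotential (R : ℝ → ℝ) (m s : ℝ) : ℝ :=
  ∫ r in m..s, max (r - m) 0 ^ 2 / R r

section truncatedPotential

variable {R : ℝ → ℝ} {A B m : ℝ}

/-- The numerator vanishes to the left of `m > A`, so the behaviour of `R` at and below `A` is
harmless and only `B` has to be avoided. -/
theorem continuousOn_truncatedPotential_integrand (hR : ContinuousOn R (Icc A B))
    (hpos : ∀ y ∈ Ioo A B, 0 < R y) (hAm : A < m) :
    ContinuousOn (fun r => max (r - m) 0 ^ 2 / R r) (Iio B) := by
  intro r hr
  have hr : r < B := hr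
  refine ContinuousAt.continuousWithinAt ?_
  rcases lt_or_ge A r with h | h
  · have h1 : ContinuousAt R r := hR.continuousAt (Icc_mem_nhds h hr)
    have h2 : R r ≠ 0 := (hpos r ⟨h, hr⟩).ne'
    fun_prop (disch := assumption)
  · have h1 : (fun r => max (r - m) 0 ^ 2 / R r) =ᶠ[𝓝 r] fun _ => 0 := by
      filter_upwards [Iio_mem_nhds (h.trans_lt hAm)] with z hz
      have hz : z < m := hz
      simp [max_eq_right (by linarith : z - m ≤ 0)]
    exact continuousAt_const.congr h1.symm

theorem intervalIntegrable_truncatedPotential (hR : ContinuousOn R (Icc A B))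
    (hpos : ∀ y ∈ Ioo A B, 0 < R y) (hAm : A < m) (hmB : m < B) {s : ℝ} (hs : s < B) :
    IntervalIntegrable (fun r => max (r - m) 0 ^ 2 / R r) MeasureTheory.volume m s :=
  ((continuousOn_truncatedPotential_integrand hR hpos hAm).mono
    (fun _ hr => hr.2.trans_lt (max_lt hmB hs))).intervalIntegrable

theorem hasDerivAt_truncatedPotential (hR : ContinuousOn R (Icc A B))
    (hpos : ∀ y ∈ Ioo A B, 0 < R y) (hAm : A < m) (hmB : m < B) {s : ℝ} (hs : s < B) :
    HasDerivAt (truncatedPotential R m) (max (s - m) 0 ^ 2 / R s) s := by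
  have hc := continuousOn_truncatedPotential_integrand hR hpos hAm
  exact intervalIntegral.integral_hasDerivAt_right
    (intervalIntegrable_truncatedPotential hR hpos hAm hmB hs)
    (hc.stronglyMeasurableAtFilter isOpen_Iio s hs) (hc.continuousAt (Iio_mem_nhds hs))

theorem truncatedPotential_of_le {s : ℝ} (hs : s ≤ m) : truncatedPotential R m s = 0 := by
  rw [truncatedPotential, intervalIntegral.integral_symm, neg_eq_zero]
  refine intervalIntegral.integral_zero_ae (Eventually.of_forall fun r hr => ?_)
  rw [uIoc_of_le hs] at hr
  simp [max_eq_right (by linarith [hr.2] : r - m ≤ 0)]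

theorem truncatedPotential_pos (hR : ContinuousOn R (Icc A B))
    (hpos : ∀ y ∈ Ioo A B, 0 < R y) (hAm : A < m) (hmB : m < B) {s : ℝ} (hms : m < s)
    (hs : s < B) : 0 < truncatedPotential R m s := by
  refine intervalIntegral.intervalIntegral_pos_of_pos_on
    (intervalIntegrable_truncatedPotential hR hpos hAm hmB hs) (fun r hr => ?_) hms
  have h1 : 0 < r - m := by linarith [hr.1]
  rw [max_eq_left h1.le]
  exact div_pos (pow_pos h1 2) (hpos r ⟨hAm.trans hr.1, hr.2.trans hs⟩)

theorem truncatedPotential_nonneg (hR : ContinuousOn R (Icc A B))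
    (hpos : ∀ y ∈ Ioo A B, 0 < R y) (hAm : A < m) (hmB : m < B) {s : ℝ}
    (hs : s < B) : 0 ≤ truncatedPotential R m s := by
  rcases le_or_gt s m with h | h
  · exact (truncatedPotential_of_le h).ge
  · exact (truncatedPotential_pos hR hpos hAm hmB h hs).le

/-- The bound does not depend on `m`, hence serves all points `x` at once when `m = F x + c`. -/
theorem truncatedPotential_le {ρ s : ℝ} (hAm : A < m) (hsB : s ≤ B) (hAB : A ≤ B) (hρ : 0 < ρ)
    (hρR : ∀ r ∈ Icc m s, ρ ≤ R r) :
    truncatedPotential R m s ≤ (B - A) ^ 2 / ρ * (B - A) := by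
  have hBA : 0 ≤ B - A := sub_nonneg.2 hAB
  rcases le_or_gt s m with h | h
  · rw [truncatedPotential_of_le h]
    positivity
  · have h1 := intervalIntegral.norm_integral_le_of_norm_le_const (a := m) (b := s)
      (f := fun r => max (r - m) 0 ^ 2 / R r) (C := (B - A) ^ 2 / ρ) (fun r hr => by
        rw [uIoc_of_le h.le] at hr
        have h2 := hρR r ⟨hr.1.le, hr.2⟩
        have h3 : 0 ≤ r - m := by linarith [hr.1]
        rw [max_eq_left h3, Real.norm_of_nonneg (div_nonneg (sq_nonneg _) (hρ.le.trans h2))]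
        have : r - m ≤ B - A := by linarith [hr.2]
        gcongr)
    refine (le_abs_self _).trans (h1.trans ?_)
    rw [abs_of_pos (sub_pos.2 h)]
    gcongr

/-- Integrating `(y - m)₊² ℓ` along a trajectory of `y' = R(y) ℓ` gives the increment of the
potential. -/
theorem integral_sq_pos_part_mul_eq (hR : ContinuousOn R (Icc A B))
    (hpos : ∀ y ∈ Ioo A B, 0 < R y) (hAm : A < m) (hmB : m < B) {y ℓ : ℝ → ℝ}
    {S T : ℝ} (hST : S ≤ T) (hℓ : ContinuousOn ℓ (Icc S T))
    (hy : ∀ t ∈ Icc S T, HasDerivWithinAt y (R (y t) * ℓ t) (Icc S T) t)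
    (hyB : ∀ t ∈ Icc S T, y t < B) :
    ∫ t in S..T, max (y t - m) 0 ^ 2 * ℓ t =
      truncatedPotential R m (y T) - truncatedPotential R m (y S) := by
  have hyc : ContinuousOn y (Icc S T) := fun t ht => (hy t ht).continuousWithinAt
  refine intervalIntegral.integral_eq_sub_of_hasDerivAt_of_le hST
    (f := fun t => truncatedPotential R m (y t)) ?_ ?_ ?_
  · intro t ht
    exact (hasDerivAt_truncatedPotential hR hpos hAm hmB (hyB t ht)).continuousAt.comp_continuousWithinAt
      (hyc t ht)
  · intro t ht
    have ht' : t ∈ Icc S T := ⟨ht.1.le, ht.2.le⟩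
    refine ((hasDerivAt_truncatedPotential hR hpos hAm hmB (hyB t ht')).comp t
      ((hy t ht').hasDerivAt (Icc_mem_nhds ht.1 ht.2))).congr_deriv ?_
    rcases le_or_gt (y t) m with h | h
    · simp [max_eq_right (sub_nonpos.2 h)]
    · have := (hpos (y t) ⟨hAm.trans h, hyB t ht'⟩).ne'
      field_simp
  · refine ContinuousOn.intervalIntegrable_of_Icc hST ?_
    fun_prop

end truncatedPotential

/-! ### Iterated integrals of functions continuous on a rectangle -/

theorem ContinuousOn.continuousOn_intervalIntegral {K : ℝ → ℝ → ℝ} {a b S T : ℝ} (hab : a ≤ b)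
    (hST : S ≤ T) (hK : ContinuousOn (fun p : ℝ × ℝ => K p.1 p.2) (Icc a b ×ˢ Icc S T)) :
    ContinuousOn (fun x => ∫ t in S..T, K x t) (Icc a b) := by
  -- Clamping both variables to the rectangle extends `K` to a continuous function on the plane.
  have hc : Continuous (Function.uncurry fun x t : ℝ =>
      K (projIcc a b hab x) (projIcc S T hST t)) := by
    refine hK.comp_continuous (f := fun p : ℝ × ℝ =>
      ((projIcc a b hab p.1 : ℝ), (projIcc S T hST p.2 : ℝ))) ?_ fun p =>
        ⟨(projIcc a b hab p.1).2, (projIcc S T hST p.2).2⟩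
    exact (continuous_subtype_val.comp (continuous_projIcc.comp continuous_fst)).prodMk
      (continuous_subtype_val.comp (continuous_projIcc.comp continuous_snd))
  refine (intervalIntegral.continuous_parametric_intervalIntegral_of_continuous'
    (μ := MeasureTheory.volume) hc S T).continuousOn.congr fun x hx => ?_
  refine intervalIntegral.integral_congr fun t ht => ?_
  rw [uIcc_of_le hST] at ht
  simp only [projIcc_of_mem hab hx, projIcc_of_mem hST ht]

theorem ContinuousOn.intervalIntegral_swap {K : ℝ → ℝ → ℝ} {a b S T : ℝ} (hab : a ≤ b)
    (hST : S ≤ T) (hK : ContinuousOn (fun p : ℝ × ℝ => K p.1 p.2) (Icc a b ×ˢ Icc S T)) :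
    ∫ x in a..b, ∫ t in S..T, K x t = ∫ t in S..T, ∫ x in a..b, K x t := by
  refine MeasureTheory.intervalIntegral_intervalIntegral_swap ?_
  rw [uIoc_of_le hab, uIoc_of_le hST]
  exact (hK.integrableOn_compact (isCompact_Icc.prod isCompact_Icc)).mono_set
    (prod_mono Ioc_subset_Icc_self Ioc_subset_Icc_self)

/-! ### Degenerate radial flows -/

/-- A classical solution `v`, with values in `[A,B]` and with `v < B` inside `(1,β)`, of
`v_t = R(v) (v'' + k v'/x - k v/x²)`, where `R > 0` on `(A,B)`. -/
structure IsRadialFlow (k : ℕ) (β A B : ℝ) (R : ℝ → ℝ) (v vx vxx : ℝ → ℝ → ℝ) : Prop where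
  range : ∀ x ∈ Icc 1 β, ∀ t ∈ Ici (0 : ℝ), v x t ∈ Icc A B
  lt : ∀ x ∈ Ioo 1 β, ∀ t ∈ Ici (0 : ℝ), v x t < B
  cont : ContinuousOn (fun p : ℝ × ℝ => v p.1 p.2) (Icc 1 β ×ˢ Ici 0)
  cont_x : ContinuousOn (fun p : ℝ × ℝ => vx p.1 p.2) (Icc 1 β ×ˢ Ici 0)
  cont_xx : ContinuousOn (fun p : ℝ × ℝ => vxx p.1 p.2) (Icc 1 β ×ˢ Ici 0)
  deriv_x : ∀ x ∈ Icc 1 β, ∀ t ∈ Ici (0 : ℝ),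
    HasDerivWithinAt (fun y => v y t) (vx x t) (Icc 1 β) x
  deriv_xx : ∀ x ∈ Icc 1 β, ∀ t ∈ Ici (0 : ℝ),
    HasDerivWithinAt (fun y => vx y t) (vxx x t) (Icc 1 β) x
  deriv_t : ∀ x ∈ Icc 1 β, ∀ t ∈ Ici (0 : ℝ),
    HasDerivWithinAt (fun s => v x s) (R (v x t) * radialOp k x (v x t) (vx x t) (vxx x t))
      (Ici 0) t
  coeff_cont : ContinuousOn R (Icc A B)
  coeff_pos : ∀ y ∈ Ioo A B, 0 < R y

/-- `F` is a stationary weak supersolution with the boundary values of `v`. -/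
structure IsRadialBarrier (k : ℕ) (β A B : ℝ) (v : ℝ → ℝ → ℝ) (F F' : ℝ → ℝ) : Prop where
  deriv : ∀ x ∈ Icc 1 β, HasDerivWithinAt F (F' x) (Icc 1 β) x
  cont_deriv : ContinuousOn F' (Icc 1 β)
  lower : ∀ x ∈ Icc 1 β, A ≤ F x
  left : ∀ t ∈ Ici (0 : ℝ), v 1 t = F 1
  right : ∀ t ∈ Ici (0 : ℝ), v β t = F β
  weak : IsWeakSupersolution k β B F F'

namespace IsRadialFlow

variable {k : ℕ} {β A B c S T : ℝ} {R F F' : ℝ → ℝ} {v vx vxx : ℝ → ℝ → ℝ}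

theorem continuousOn_radialOp (h : IsRadialFlow k β A B R v vx vxx) :
    ContinuousOn (fun p : ℝ × ℝ =>
      radialOp k p.1 (v p.1 p.2) (vx p.1 p.2) (vxx p.1 p.2)) (Icc 1 β ×ˢ Ici 0) := by
  have h0 := h.cont
  have h1 := h.cont_x
  have h2 := h.cont_xx
  have hx : ∀ p ∈ Icc 1 β ×ˢ Ici (0 : ℝ), p.1 ≠ 0 := fun p hp => by linarith [hp.1.1]
  have hx2 : ∀ p ∈ Icc 1 β ×ˢ Ici (0 : ℝ), p.1 ^ 2 ≠ 0 := fun p hp => pow_ne_zero 2 (hx p hp)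
  unfold radialOp
  fun_prop (disch := assumption)

theorem continuousOn_sq_pos_part (h : IsRadialFlow k β A B R v vx vxx)
    (hF : IsRadialBarrier k β A B v F F') (c : ℝ) :
    ContinuousOn (fun p : ℝ × ℝ => max (v p.1 p.2 - F p.1 - c) 0 ^ 2) (Icc 1 β ×ˢ Ici 0) := by
  have h0 := h.cont
  have h1 : ContinuousOn (fun p : ℝ × ℝ => F p.1) (Icc 1 β ×ˢ Ici 0) :=
    ContinuousOn.comp (g := F) (t := Icc 1 β) (fun x hx => (hF.deriv x hx).continuousWithinAt)
      continuousOn_fst fun p hp => hp.1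
  exact (((h0.sub h1).sub continuousOn_const).sup continuousOn_const).pow 2

theorem continuousOn_dissipation (h : IsRadialFlow k β A B R v vx vxx)
    (hF : IsRadialBarrier k β A B v F F') (c : ℝ) :
    ContinuousOn (fun p : ℝ × ℝ => p.1 ^ k * (max (v p.1 p.2 - F p.1 - c) 0 ^ 2 / p.1 ^ 2))
      (Icc 1 β ×ˢ Ici 0) := by
  have h0 := h.continuousOn_sq_pos_part hF c
  have hx2 : ∀ p ∈ Icc 1 β ×ˢ Ici (0 : ℝ), p.1 ^ 2 ≠ 0 := fun p hp =>
    pow_ne_zero 2 (by linarith [hp.1.1])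
  fun_prop (disch := assumption)

/-- The increment over `[S,T]` of the truncated potential at the point `x`. -/
noncomputable def increment (k : ℕ) (F : ℝ → ℝ) (v vx vxx : ℝ → ℝ → ℝ) (c S T x : ℝ) : ℝ :=
  ∫ t in S..T, max (v x t - F x - c) 0 ^ 2 * radialOp k x (v x t) (vx x t) (vxx x t)

theorem continuousOn_increment (h : IsRadialFlow k β A B R v vx vxx)
    (hF : IsRadialBarrier k β A B v F F') (hβ : 1 < β) (hS : 0 ≤ S) (hST : S ≤ T) :
    ContinuousOn (increment k F v vx vxx c S T) (Icc 1 β) := by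
  have hsub : Icc 1 β ×ˢ Icc S T ⊆ Icc 1 β ×ˢ Ici (0 : ℝ) :=
    prod_mono subset_rfl fun t ht => hS.trans ht.1
  exact (((h.continuousOn_sq_pos_part hF c).mul h.continuousOn_radialOp).mono
    hsub).continuousOn_intervalIntegral (K := fun x t => max (v x t - F x - c) 0 ^ 2 *
      radialOp k x (v x t) (vx x t) (vxx x t)) hβ.le hST

/-- Fubini converts increments in time at fixed `x` into the spatial inequality at fixed `t`.
Defining the increment as a time integral keeps it continuous in `x` even where `F x + c ≥ B` and
the potential is unavailable. -/
theorem integral_increment_le (h : IsRadialFlow k β A B R v vx vxx)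
    (hF : IsRadialBarrier k β A B v F F') (hβ : 1 < β) (hc : 0 < c) (hS : 0 ≤ S) (hST : S ≤ T) :
    ∫ x in 1..β, x ^ k * increment k F v vx vxx c S T x ≤
      -(c * k * ∫ t in S..T, ∫ x in 1..β, x ^ k * (max (v x t - F x - c) 0 ^ 2 / x ^ 2)) := by
  have hsub : Icc 1 β ×ˢ Icc S T ⊆ Icc 1 β ×ˢ Ici (0 : ℝ) :=
    prod_mono subset_rfl fun t ht => hS.trans ht.1
  have hmaps : MapsTo Prod.swap (Icc S T ×ˢ Icc 1 β) (Icc 1 β ×ˢ Icc S T) :=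
    fun p hp => ⟨hp.2, hp.1⟩
  have hK : ContinuousOn (fun p : ℝ × ℝ => p.1 ^ k * (max (v p.1 p.2 - F p.1 - c) 0 ^ 2 *
      radialOp k p.1 (v p.1 p.2) (vx p.1 p.2) (vxx p.1 p.2))) (Icc 1 β ×ˢ Icc S T) :=
    ((Continuous.continuousOn (by fun_prop)).mul
      ((h.continuousOn_sq_pos_part hF c).mul h.continuousOn_radialOp)).mono hsub
  have hG := (h.continuousOn_dissipation hF c).mono hsub
  have hK' := (hK.comp continuous_swap.continuousOn hmaps).continuousOn_intervalIntegral
    (K := fun t x => x ^ k * (max (v x t - F x - c) 0 ^ 2 *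
      radialOp k x (v x t) (vx x t) (vxx x t))) hST hβ.le
  have hG' := (hG.comp continuous_swap.continuousOn hmaps).continuousOn_intervalIntegral
    (K := fun t x => x ^ k * (max (v x t - F x - c) 0 ^ 2 / x ^ 2)) hST hβ.le
  have hswap := hK.intervalIntegral_swap (K := fun x t => x ^ k * (max (v x t - F x - c) 0 ^ 2 *
      radialOp k x (v x t) (vx x t) (vxx x t))) hβ.le hST
  simp only [intervalIntegral.integral_const_mul] at hswap
  simp only [increment]
  rw [hswap, ← intervalIntegral.integral_const_mul, ← intervalIntegral.integral_neg]
  refine intervalIntegral.integral_mono_on hST (hK'.intervalIntegrable_of_Icc hST)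
    ((continuousOn_const.mul hG').neg.intervalIntegrable_of_Icc hST) fun t ht => ?_
  have ht0 : t ∈ Ici (0 : ℝ) := hS.trans ht.1
  exact integral_sq_pos_part_mul_radialOp_le hβ hc (fun x hx => h.deriv_x x hx t ht0)
    (fun x hx => h.deriv_xx x hx t ht0)
    (h.cont_xx.comp (f := fun x : ℝ => (x, t)) (by fun_prop) fun x hx => ⟨hx, ht0⟩)
    hF.deriv hF.cont_deriv (fun x hx => (h.range x hx t ht0).2) (hF.left t ht0).le
    (hF.right t ht0).le hF.weak

theorem increment_eq_zero {x : ℝ} (hle : ∀ t ∈ Icc S T, v x t ≤ F x + c) (hST : S ≤ T) :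
    increment k F v vx vxx c S T x = 0 := by
  refine intervalIntegral.integral_zero_ae (Eventually.of_forall fun t ht => ?_)
  rw [uIoc_of_le hST] at ht
  rw [max_eq_right (by linarith [hle t ⟨ht.1.le, ht.2⟩])]
  simp

theorem increment_eq_sub (h : IsRadialFlow k β A B R v vx vxx)
    (hF : IsRadialBarrier k β A B v F F') (hc : 0 < c) (hS : 0 ≤ S) (hST : S ≤ T) {x : ℝ}
    (hx : x ∈ Ioo 1 β) (hB : F x + c < B) :
    increment k F v vx vxx c S T x =
      truncatedPotential R (F x + c) (v x T) - truncatedPotential R (F x + c) (v x S) := by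
  have hx' : x ∈ Icc 1 β := ⟨hx.1.le, hx.2.le⟩
  have hsub : Icc S T ⊆ Ici 0 := fun t ht => hS.trans ht.1
  rw [← integral_sq_pos_part_mul_eq h.coeff_cont h.coeff_pos
    (by linarith [hF.lower x hx'] : A < F x + c) hB hST (y := fun t => v x t)
    (ℓ := fun t => radialOp k x (v x t) (vx x t) (vxx x t))
    (h.continuousOn_radialOp.comp (f := fun t : ℝ => (x, t)) (by fun_prop)
      fun t ht => ⟨hx', hsub ht⟩)
    (fun t ht => (h.deriv_t x hx' t (hsub ht)).mono hsub)
    (fun t ht => h.lt x hx t (hsub ht))]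
  simp only [increment, sub_sub]

/-- Either `v` never exceeds `F + c` at `x`, or the potential at level `F x + c` is available. -/
theorem le_barrier_or (h : IsRadialFlow k β A B R v vx vxx)
    (hF : IsRadialBarrier k β A B v F F') (hc : 0 < c) {x : ℝ} (hx : x ∈ Icc 1 β) :
    (∀ t ∈ Ici (0 : ℝ), v x t ≤ F x + c) ∨ (x ∈ Ioo 1 β ∧ F x + c < B) := by
  rcases hx.1.eq_or_lt with rfl | h1
  · exact Or.inl fun t ht => by linarith [hF.left t ht]
  rcases hx.2.eq_or_lt with rfl | h2
  · exact Or.inl fun t ht => by linarith [hF.right t ht]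
  rcases lt_or_ge (F x + c) B with h3 | h3
  · exact Or.inr ⟨⟨h1, h2⟩, h3⟩
  · exact Or.inl fun t ht => (h.range x hx t ht).2.trans h3

/-- Comparison with the stationary barrier `F + c`. -/
theorem le_barrier_of_le (h : IsRadialFlow k β A B R v vx vxx)
    (hF : IsRadialBarrier k β A B v F F') (hβ : 1 < β) (hc : 0 < c) (hS : 0 ≤ S) (hST : S ≤ T)
    (hle : ∀ x ∈ Icc 1 β, v x S ≤ F x + c) : ∀ x ∈ Icc 1 β, v x T ≤ F x + c := by
  have hnonneg : ∀ x ∈ Icc 1 β, 0 ≤ increment k F v vx vxx c S T x := fun x hx => by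
    rcases h.le_barrier_or hF hc hx with h1 | ⟨hx', h1⟩
    · exact (increment_eq_zero (fun t ht => h1 t (hS.trans ht.1)) hST).ge
    · rw [h.increment_eq_sub hF hc hS hST hx' h1, truncatedPotential_of_le (hle x hx), sub_zero]
      exact truncatedPotential_nonneg h.coeff_cont h.coeff_pos (by linarith [hF.lower x hx]) h1
        (h.lt x hx' T (hS.trans hST))
  by_contra! hex
  obtain ⟨x, hx, hlt⟩ := hex
  have hpos : 0 < increment k F v vx vxx c S T x := by
    rcases h.le_barrier_or hF hc hx with h1 | ⟨hx', h1⟩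
    · exact absurd (h1 T (hS.trans hST)) (not_le.2 hlt)
    · rw [h.increment_eq_sub hF hc hS hST hx' h1, truncatedPotential_of_le (hle x hx), sub_zero]
      exact truncatedPotential_pos h.coeff_cont h.coeff_pos (by linarith [hF.lower x hx]) h1 hlt
        (h.lt x hx' T (hS.trans hST))
  have h1 : 0 < ∫ x in 1..β, x ^ k * increment k F v vx vxx c S T x := by
    refine intervalIntegral.integral_pos hβ
      ((Continuous.continuousOn (by fun_prop)).mul (h.continuousOn_increment hF hβ hS hST))
      (fun y hy => mul_nonneg (pow_nonneg (by linarith [hy.1]) k) (hnonneg y ⟨hy.1.le, hy.2⟩))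
      ⟨x, hx, mul_pos (pow_pos (by linarith [hx.1]) k) hpos⟩
  have h2 := h.integral_increment_le hF hβ hc hS hST
  have h3 : 0 ≤ ∫ t in S..T, ∫ x in 1..β, x ^ k * (max (v x t - F x - c) 0 ^ 2 / x ^ 2) := by
    refine intervalIntegral.integral_nonneg hST fun t _ =>
      intervalIntegral.integral_nonneg hβ.le fun x hx => ?_
    have : 0 < x := by linarith [hx.1]
    positivity
  have h4 : 0 ≤ c * k * ∫ t in S..T, ∫ x in 1..β,
      x ^ k * (max (v x t - F x - c) 0 ^ 2 / x ^ 2) := by positivity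
  linarith

/-- The increment is at least minus the initial potential. The latter is bounded in `x`, since the
initial values that exceed the barrier stay away from both ends of `[A,B]`. -/
theorem exists_neg_le_increment (h : IsRadialFlow k β A B R v vx vxx)
    (hF : IsRadialBarrier k β A B v F F') (hAB : A ≤ B) (hc : 0 < c) :
    ∃ C : ℝ, ∀ T, 0 ≤ T → ∀ x ∈ Icc 1 β, -C ≤ increment k F v vx vxx c 0 T x := by
  have h0 : (0 : ℝ) ∈ Ici (0 : ℝ) := self_mem_Ici
  have hv0 : ContinuousOn (fun x => v x 0) (Icc 1 β) :=
    h.cont.comp (f := fun x : ℝ => (x, (0 : ℝ))) (by fun_prop) fun x hx => ⟨hx, h0⟩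
  have hFc : ContinuousOn F (Icc 1 β) := fun x hx => (hF.deriv x hx).continuousWithinAt
  -- This set is compact and avoids `1` and `β`, where `v = F`; hence `v(·,0)` has a maximum below
  -- `B` on it.
  set E : Set ℝ := {x ∈ Icc 1 β | F x + c ≤ v x 0} with hE
  have hEc : IsCompact E :=
    isCompact_Icc.of_isClosed_subset
      (isClosed_Icc.isClosed_le (hFc.add continuousOn_const) hv0) (fun x hx => hx.1)
  obtain ⟨M, hMB, hM⟩ : ∃ M < B, ∀ x ∈ E, v x 0 ≤ M := by
    rcases E.eq_empty_or_nonempty with hem | hne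
    · exact ⟨B - 1, by linarith, by simp [hem]⟩
    · obtain ⟨z, hz, hmax⟩ := hEc.exists_isMaxOn hne (hv0.mono fun x hx => hx.1)
      refine ⟨v z 0, h.lt z ⟨?_, ?_⟩ 0 h0, fun x hx => hmax hx⟩
      · rcases hz.1.1.eq_or_lt with rfl | h1
        · linarith [hz.2, hF.left 0 h0]
        · exact h1
      · rcases hz.1.2.eq_or_lt with rfl | h1
        · linarith [hz.2, hF.right 0 h0]
        · exact h1
  obtain ⟨ρ, hρ, hρR⟩ : ∃ ρ > 0, ∀ r ∈ Icc (A + c) M, ρ ≤ R r := by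
    rcases (Icc (A + c) M).eq_empty_or_nonempty with hem | hne
    · exact ⟨1, one_pos, by simp [hem]⟩
    · obtain ⟨z, hz, hmin⟩ := isCompact_Icc.exists_isMinOn hne (h.coeff_cont.mono fun r hr =>
        ⟨by linarith [hr.1], hr.2.trans hMB.le⟩)
      exact ⟨R z, h.coeff_pos z ⟨by linarith [hz.1], hz.2.trans_lt hMB⟩, fun r hr => hmin hr⟩
  have hBA : 0 ≤ B - A := sub_nonneg.2 hAB
  have hC : 0 ≤ (B - A) ^ 2 / ρ * (B - A) := by positivity
  refine ⟨(B - A) ^ 2 / ρ * (B - A), fun T hT x hx => ?_⟩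
  rcases h.le_barrier_or hF hc hx with h1 | ⟨hx', h1⟩
  · rw [increment_eq_zero (fun t ht => h1 t ht.1) hT]
    linarith
  · have hAm : A < F x + c := by linarith [hF.lower x hx]
    rw [h.increment_eq_sub hF hc le_rfl hT hx' h1]
    have h2 := truncatedPotential_nonneg h.coeff_cont h.coeff_pos hAm h1 (h.lt x hx' T hT)
    have h3 : truncatedPotential R (F x + c) (v x 0) ≤ (B - A) ^ 2 / ρ * (B - A) :=
      truncatedPotential_le hAm (h.range x hx 0 h0).2 hAB hρ fun r hr =>
        hρR r ⟨by linarith [hr.1, hF.lower x hx], hr.2.trans (hM x ⟨hx, hr.1.trans hr.2⟩)⟩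
    linarith

theorem exists_dissipation_le (h : IsRadialFlow k β A B R v vx vxx)
    (hF : IsRadialBarrier k β A B v F F') (hk : 1 ≤ k) (hβ : 1 < β) (hAB : A ≤ B) (hc : 0 < c) :
    ∃ C : ℝ, ∀ T, 0 ≤ T →
      ∫ t in 0..T, ∫ x in 1..β, x ^ k * (max (v x t - F x - c) 0 ^ 2 / x ^ 2) ≤ C := by
  obtain ⟨C, hC⟩ := h.exists_neg_le_increment hF hAB hc
  have hck : 0 < c * k := by
    have : (0 : ℝ) < k := by exact_mod_cast hk
    positivity
  refine ⟨(∫ x in 1..β, x ^ k * C) / (c * k), fun T hT => ?_⟩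
  rw [le_div_iff₀' hck]
  have h1 := h.integral_increment_le hF hβ hc le_rfl hT
  have h2 : ∫ x in 1..β, -(x ^ k * C) ≤ ∫ x in 1..β, x ^ k * increment k F v vx vxx c 0 T x := by
    refine intervalIntegral.integral_mono_on hβ.le (Continuous.intervalIntegrable (by fun_prop) _ _)
      (ContinuousOn.intervalIntegrable_of_Icc hβ.le ((Continuous.continuousOn (by fun_prop)).mul
        (h.continuousOn_increment hF hβ le_rfl hT))) fun x hx => ?_
    have := mul_le_mul_of_nonneg_left (hC T hT x hx) (pow_nonneg (by linarith [hx.1] : 0 ≤ x) k)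
    linarith
  rw [intervalIntegral.integral_neg] at h2
  linarith

/-- If every excess over the barrier spreads over an interval of fixed length, then `v` is
eventually below `F + ε`. -/
theorem eventually_le_barrier (h : IsRadialFlow k β A B R v vx vxx)
    (hF : IsRadialBarrier k β A B v F F') (hk : 1 ≤ k) (hβ : 1 < β) (hAB : A ≤ B) {ε : ℝ}
    (hε : 0 < ε)
    (hwin : ∃ l > 0, ∀ t ∈ Ici (0 : ℝ), ∀ x ∈ Icc 1 β, F x + ε < v x t →
      ∃ p, 1 ≤ p ∧ p + l ≤ β ∧ ∀ z ∈ Icc p (p + l), F z + ε / 2 ≤ v z t) :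
    ∃ T, 0 ≤ T ∧ ∀ t, T ≤ t → ∀ x ∈ Icc 1 β, v x t ≤ F x + ε := by
  by_contra! hcon
  -- By comparison, an excess at some later time forces an excess now.
  have hex : ∀ t, 0 ≤ t → ∃ x ∈ Icc 1 β, F x + ε < v x t := fun t ht => by
    by_contra! hle
    obtain ⟨s, hs, x, hx, hlt⟩ := hcon t ht
    exact absurd (h.le_barrier_of_le hF hβ hε ht hs hle x hx) (not_le.2 hlt)
  obtain ⟨l, hl, hwin⟩ := hwin
  obtain ⟨C, hC⟩ := h.exists_dissipation_le hF hk hβ hAB (c := ε / 4) (by positivity)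
  -- On the window `v - F - ε/4 ≥ ε/4`, and the weight satisfies `x^k/x² ≥ 1/β²`.
  set κ : ℝ := (ε / 4) ^ 2 / β ^ 2 * l with hκ
  have hκ0 : 0 < κ := by positivity
  have hGc := h.continuousOn_dissipation hF (ε / 4)
  have hlow : ∀ t, 0 ≤ t →
      κ ≤ ∫ x in 1..β, x ^ k * (max (v x t - F x - ε / 4) 0 ^ 2 / x ^ 2) := fun t ht => by
    obtain ⟨x, hx, hlt⟩ := hex t ht
    obtain ⟨p, hp1, hpl, hp⟩ := hwin t ht x hx hlt
    have hcont : ContinuousOn (fun x => x ^ k * (max (v x t - F x - ε / 4) 0 ^ 2 / x ^ 2))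
        (Icc 1 β) :=
      hGc.comp (f := fun x : ℝ => (x, t)) (by fun_prop) fun x hx => ⟨hx, ht⟩
    have hpl' : p ≤ p + l := by linarith
    have h1 : ∫ _ in p..(p + l), (ε / 4) ^ 2 / β ^ 2 ≤
        ∫ x in p..(p + l), x ^ k * (max (v x t - F x - ε / 4) 0 ^ 2 / x ^ 2) := by
      refine intervalIntegral.integral_mono_on hpl' (by simp)
        ((hcont.mono (Icc_subset_Icc hp1 hpl)).intervalIntegrable_of_Icc hpl') fun z hz => ?_
      have hz1 : 1 ≤ z := hp1.trans hz.1
      have hz0 : 0 < z := by linarith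
      have hu : ε / 4 ≤ max (v z t - F z - ε / 4) 0 :=
        le_max_of_le_left (by linarith [hp z hz])
      calc (ε / 4) ^ 2 / β ^ 2 ≤ max (v z t - F z - ε / 4) 0 ^ 2 / z ^ 2 := by
            have : z ≤ β := hz.2.trans hpl
            gcongr
        _ ≤ z ^ k * (max (v z t - F z - ε / 4) 0 ^ 2 / z ^ 2) :=
            le_mul_of_one_le_left (by positivity) (one_le_pow₀ hz1)
    rw [intervalIntegral.integral_const, smul_eq_mul] at h1
    have h2 : κ ≤ ∫ x in p..(p + l), x ^ k * (max (v x t - F x - ε / 4) 0 ^ 2 / x ^ 2) := by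
      refine le_of_eq_of_le ?_ h1
      rw [hκ]; ring
    refine h2.trans (intervalIntegral.integral_mono_interval hp1 hpl' hpl ?_
      (hcont.intervalIntegrable_of_Icc hβ.le))
    refine (MeasureTheory.ae_restrict_mem measurableSet_Ioc).mono fun z hz => ?_
    have : 0 < z := by linarith [hz.1]
    simp only [Pi.zero_apply]
    positivity
  set T : ℝ := max C 0 / κ + 1 with hT
  have hT0 : 0 ≤ T := by positivity
  have hGi : IntervalIntegrable (fun t =>
      ∫ x in 1..β, x ^ k * (max (v x t - F x - ε / 4) 0 ^ 2 / x ^ 2)) MeasureTheory.volume 0 T := by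
    refine ContinuousOn.intervalIntegrable_of_Icc hT0 ?_
    exact (hGc.comp (s := Icc 0 T ×ˢ Icc 1 β) continuous_swap.continuousOn
      fun p hp => ⟨hp.2, hp.1.1⟩).continuousOn_intervalIntegral
      (K := fun t x => x ^ k * (max (v x t - F x - ε / 4) 0 ^ 2 / x ^ 2)) hT0 hβ.le
  have h1 : ∫ _ in 0..T, κ ≤
      ∫ t in 0..T, ∫ x in 1..β, x ^ k * (max (v x t - F x - ε / 4) 0 ^ 2 / x ^ 2) :=
    intervalIntegral.integral_mono_on hT0 (by simp) hGi fun t ht => hlow t ht.1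
  rw [intervalIntegral.integral_const, smul_eq_mul, sub_zero] at h1
  have h2 := h1.trans (hC T hT0)
  have h3 : T * κ = max C 0 + κ := by
    rw [hT]; field_simp
  linarith [le_max_left C 0]

end IsRadialFlow

/-! ### The stationary profile -/

/-- The general solution `a x + b / x^k` of `g'' + k g'/x - k g/x² = 0`. -/
noncomputable def radialSolution (k : ℕ) (a b x : ℝ) : ℝ := a * x + b / x ^ k

/-- The derivative of `radialSolution`. -/
noncomputable def radialSolutionDeriv (k : ℕ) (a b x : ℝ) : ℝ := a - k * b / x ^ (k + 1)

theorem hasDerivAt_radialSolution (k : ℕ) (a b : ℝ) {x : ℝ} (hx : x ≠ 0) :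
    HasDerivAt (radialSolution k a b) (radialSolutionDeriv k a b x) x := by
  have h1 := (hasDerivAt_const x b).div (hasDerivAt_pow_of_ne_zero k hx) (pow_ne_zero k hx)
  refine (((hasDerivAt_id x).const_mul a).add h1).congr_deriv ?_
  rw [radialSolutionDeriv]
  field_simp
  ring

theorem hasDerivAt_radialSolutionDeriv (k : ℕ) (a b : ℝ) {x : ℝ} (hx : x ≠ 0) :
    HasDerivAt (radialSolutionDeriv k a b)
      (k * radialSolution k a b x / x ^ 2 - k * radialSolutionDeriv k a b x / x) x := by
  have h1 := (hasDerivAt_const x (k * b)).div (hasDerivAt_pow_of_ne_zero (k + 1) hx)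
    (pow_ne_zero (k + 1) hx)
  refine (h1.const_sub a).congr_deriv ?_
  rw [radialSolutionDeriv, radialSolution]
  push_cast
  field_simp
  ring

/-- The parameters of the stationary state: it equals `1` up to `l` and `a x + b / x^k` from `l`
on, with a `C¹` junction if `l` is not the endpoint `1`. -/
structure IsStationaryData (k : ℕ) (α β a b l : ℝ) : Prop where
  one_le : 1 ≤ l
  lt : l < β
  left : radialSolution k a b l = 1
  right : radialSolution k a b β = α
  deriv_nonneg : ∀ x ∈ Icc l β, 0 ≤ radialSolutionDeriv k a b x
  junction : l = 1 ∨ radialSolutionDeriv k a b l = 0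

/-- The stationary state. -/
noncomputable def stationary (k : ℕ) (a b l x : ℝ) : ℝ := radialSolution k a b (max x l)

/-- The derivative of `stationary`. -/
noncomputable def stationaryDeriv (k : ℕ) (a b l x : ℝ) : ℝ := radialSolutionDeriv k a b (max x l)

namespace IsStationaryData

variable {k : ℕ} {α β a b l : ℝ}

theorem stationary_of_le (h : IsStationaryData k α β a b l) {x : ℝ} (hx : x ≤ l) :
    stationary k a b l x = 1 := by
  rw [stationary, max_eq_right hx, h.left]

theorem stationary_of_ge {x : ℝ} (hx : l ≤ x) :
    stationary k a b l x = radialSolution k a b x := by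
  rw [stationary, max_eq_left hx]

theorem stationary_right (h : IsStationaryData k α β a b l) : stationary k a b l β = α := by
  rw [stationary_of_ge h.lt.le, h.right]

theorem hasDerivWithinAt (h : IsStationaryData k α β a b l) {x : ℝ} (hx : x ∈ Icc 1 β) :
    HasDerivWithinAt (stationary k a b l) (stationaryDeriv k a b l x) (Icc 1 β) x := by
  have hx0 : x ≠ 0 := by linarith [hx.1]
  rcases lt_trichotomy x l with hxl | rfl | hxl
  · have hd : stationaryDeriv k a b l x = 0 := by
      rw [stationaryDeriv, max_eq_right hxl.le]
      exact h.junction.resolve_left (by linarith [hx.1])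
    rw [hd]
    refine ((hasDerivAt_const x (1 : ℝ)).congr_of_eventuallyEq ?_).hasDerivWithinAt
    filter_upwards [Iio_mem_nhds hxl] with z hz using h.stationary_of_le (mem_Iio.1 hz).le
  · have hd : stationaryDeriv k a b x x = radialSolutionDeriv k a b x := by
      rw [stationaryDeriv, max_self]
    have hg := hasDerivAt_radialSolution k a b hx0
    rw [hd]
    have hright : HasDerivWithinAt (stationary k a b x) (radialSolutionDeriv k a b x) (Ici x) x :=
      hg.hasDerivWithinAt.congr (fun z hz => stationary_of_ge hz) (stationary_of_ge le_rfl)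
    -- If the junction is the endpoint `1`, only the right derivative counts; otherwise both
    -- one-sided derivatives are zero.
    rcases h.junction with rfl | h0
    · exact hright.mono Icc_subset_Ici_self
    · rw [h0] at hright ⊢
      have hleft : HasDerivWithinAt (stationary k a b x) 0 (Iic x) x :=
        (hasDerivWithinAt_const x (Iic x) (1 : ℝ)).congr (fun z hz => h.stationary_of_le hz)
          (h.stationary_of_le le_rfl)
      exact (hleft.union hright).mono fun z _ => (le_total z x)
  · rw [stationaryDeriv, max_eq_left hxl.le]
    refine ((hasDerivAt_radialSolution k a b hx0).congr_of_eventuallyEq ?_).hasDerivWithinAt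
    filter_upwards [Ioi_mem_nhds hxl] with z hz using stationary_of_ge (mem_Ioi.1 hz).le

theorem continuous_deriv (h : IsStationaryData k α β a b l) :
    Continuous (stationaryDeriv k a b l) := by
  have : ∀ x : ℝ, max x l ^ (k + 1) ≠ 0 := fun x =>
    pow_ne_zero _ (by linarith [le_max_right x l, h.one_le])
  unfold stationaryDeriv radialSolutionDeriv
  fun_prop (disch := assumption)

theorem monotoneOn (h : IsStationaryData k α β a b l) :
    MonotoneOn (stationary k a b l) (Icc 1 β) := by
  refine monotoneOn_of_hasDerivWithinAt_nonneg (convex_Icc 1 β)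
    (fun x hx => (h.hasDerivWithinAt hx).continuousWithinAt)
    (fun x hx => (h.hasDerivWithinAt (interior_subset hx)).mono interior_subset) fun x hx => ?_
  exact h.deriv_nonneg _ ⟨le_max_right _ _, max_le (interior_subset hx).2 h.lt.le⟩

theorem one_lt (h : IsStationaryData k α β a b l) : 1 < β := h.one_le.trans_lt h.lt

theorem mem_Icc (h : IsStationaryData k α β a b l) {x : ℝ} (hx : x ∈ Icc 1 β) :
    stationary k a b l x ∈ Icc 1 α := by
  have h1 := h.monotoneOn ⟨le_rfl, h.one_lt.le⟩ hx hx.1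
  have h2 := h.monotoneOn hx ⟨h.one_lt.le, le_rfl⟩ hx.2
  rw [h.stationary_of_le h.one_le] at h1
  rw [h.stationary_right] at h2
  exact ⟨h1, h2⟩

/-- The weak form of the equation for the stationary state. -/
theorem integral_weak_form (h : IsStationaryData k α β a b l) {q q' : ℝ → ℝ}
    (hq : ∀ x ∈ Icc 1 β, HasDerivWithinAt q (q' x) (Icc 1 β) x) (hq' : ContinuousOn q' (Icc 1 β))
    (hq1 : q 1 = 0) (hqβ : q β = 0) :
    ∫ x in 1..β, x ^ k * (q' x * stationaryDeriv k a b l x + k * q x * stationary k a b l x / x ^ 2)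
      = ∫ x in 1..l, x ^ k * (k * q x / x ^ 2) := by
  have hqc : ContinuousOn q (Icc 1 β) := fun x hx => (hq x hx).continuousWithinAt
  have hFc : ContinuousOn (stationary k a b l) (Icc 1 β) := fun x hx =>
    (h.hasDerivWithinAt hx).continuousWithinAt
  have hF'c : ContinuousOn (stationaryDeriv k a b l) (Icc 1 β) := h.continuous_deriv.continuousOn
  have hx2 : ∀ x ∈ Icc 1 β, x ^ 2 ≠ 0 := fun x hx => pow_ne_zero 2 (by linarith [hx.1])
  have hcont : ContinuousOn (fun x => x ^ k * (q' x * stationaryDeriv k a b l x +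
      k * q x * stationary k a b l x / x ^ 2)) (Icc 1 β) := by
    fun_prop (disch := assumption)
  have hi1 := (hcont.mono (Icc_subset_Icc le_rfl h.lt.le)).intervalIntegrable_of_Icc
    (μ := MeasureTheory.volume) h.one_le
  have hi2 := (hcont.mono (Icc_subset_Icc h.one_le le_rfl)).intervalIntegrable_of_Icc
    (μ := MeasureTheory.volume) h.lt.le
  rw [← intervalIntegral.integral_add_adjacent_intervals hi1 hi2]
  -- The integrand is the exact derivative of `q x^k g'`. Its boundary term at `l` vanishes because
  -- `q 1 = 0` if `l = 1`, and because `g'(l) = 0` otherwise.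
  have e1 : ∫ x in l..β, x ^ k * (q' x * stationaryDeriv k a b l x +
      k * q x * stationary k a b l x / x ^ 2) = 0 := by
    have hsub : Icc l β ⊆ Icc 1 β := Icc_subset_Icc h.one_le le_rfl
    have hG : ∀ x ∈ Icc l β, HasDerivWithinAt
        (fun x => q x * (x ^ k * radialSolutionDeriv k a b x))
        (x ^ k * (q' x * stationaryDeriv k a b l x + k * q x * stationary k a b l x / x ^ 2))
        (Icc l β) x := fun x hx => by
      have hx0 : x ≠ 0 := by linarith [hx.1, h.one_le]
      refine (((hq x (hsub hx)).mono hsub).mul ((hasDerivAt_pow_of_ne_zero k hx0).mul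
        (hasDerivAt_radialSolutionDeriv k a b hx0)).hasDerivWithinAt).congr_deriv ?_
      rw [stationary_of_ge hx.1, stationaryDeriv, max_eq_left hx.1]
      simp only [Pi.mul_apply]
      ring
    rw [intervalIntegral.integral_eq_sub_of_hasDerivAt_of_le h.lt.le
      (fun x hx => (hG x hx).continuousWithinAt)
      (fun x hx => (hG x ⟨hx.1.le, hx.2.le⟩).hasDerivAt (Icc_mem_nhds hx.1 hx.2)) hi2]
    rcases h.junction with rfl | h0
    · simp [hq1, hqβ]
    · simp [h0, hqβ]
  rw [e1, add_zero]
  refine intervalIntegral.integral_congr_ae (Eventually.of_forall fun x hx => ?_)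
  rw [uIoc_of_le h.one_le] at hx
  rw [h.stationary_of_le hx.2, stationaryDeriv, max_eq_right hx.2,
    h.junction.resolve_left (by linarith [hx.1, hx.2])]
  ring

/-- On the contact interval `L 1 = -k/x² ≤ 0`; beyond it the equation holds, and the `C¹` junction
adds no singular part. -/
theorem isWeakSupersolution (h : IsStationaryData k α β a b l) (B : ℝ) :
    IsWeakSupersolution k β B (stationary k a b l) (stationaryDeriv k a b l) := by
  intro q q' hq hq' hq0 hq1 hqβ _
  rw [h.integral_weak_form hq hq' hq1 hqβ]
  refine intervalIntegral.integral_nonneg h.one_le fun x hx => ?_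
  have h1 : 0 < x := by linarith [hx.1]
  have h2 := hq0 x ⟨hx.1, hx.2.trans h.lt.le⟩
  positivity

/-- The contact interval contributes with the wrong sign, but there `-F = -1 = B`, so admissible
test functions vanish. -/
theorem isWeakSupersolution_neg (h : IsStationaryData k α β a b l) :
    IsWeakSupersolution k β (-1) (fun x => -stationary k a b l x)
      (fun x => -stationaryDeriv k a b l x) := by
  intro q q' hq hq' _ hq1 hqβ hq0
  have e : ∫ x in 1..β, x ^ k * (q' x * -stationaryDeriv k a b l x +
      k * q x * -stationary k a b l x / x ^ 2) = 0 := by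
    have e1 : ∀ x, x ^ k * (q' x * -stationaryDeriv k a b l x +
        k * q x * -stationary k a b l x / x ^ 2) = -(x ^ k * (q' x * stationaryDeriv k a b l x +
        k * q x * stationary k a b l x / x ^ 2)) := fun x => by ring
    simp only [e1]
    rw [intervalIntegral.integral_neg, h.integral_weak_form hq hq' hq1 hqβ, neg_eq_zero]
    refine intervalIntegral.integral_zero_ae (Eventually.of_forall fun x hx => ?_)
    rw [uIoc_of_le h.one_le] at hx
    rw [hq0 x ⟨hx.1.le, hx.2.trans h.lt.le⟩ (neg_le_neg (h.stationary_of_le hx.2).le)]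
    simp
  exact e.ge

end IsStationaryData

/-! ### Convergence -/

/-- Solutions converge uniformly to the stationary state. -/
theorem IsClassicalSolution.tendstoUniformlyOn {k : ℕ} (hk : 1 ≤ k) {α β a b l : ℝ} (hα : 1 < α)
    {Q : ℝ → ℝ} {f : ℝ → ℝ → ℝ} (hQ : IsDegenerateCoefficient α Q)
    (hf : IsClassicalSolution (k + 1) α β Q f) (h0 : StrictMonoOn (fun x => f x 0) (Icc 1 β))
    (hd : IsStationaryData k α β a b l) :
    TendstoUniformlyOn (fun t x => f x t) (stationary k a b l) atTop (Icc 1 β) := by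
  have hβ : 1 < β := hd.one_lt
  have hmono : ∀ t ∈ Ici (0 : ℝ), MonotoneOn (fun x => f x t) (Icc 1 β) := fun t ht =>
    hf.monotoneOn (by omega) hQ h0.monotoneOn ht
  obtain ⟨fx, fxx, ft, hcx, hcxx, -, hder⟩ := hf.equation
  have hdt : ∀ x ∈ Icc 1 β, ∀ t ∈ Ici (0 : ℝ), HasDerivWithinAt (fun s => f x s)
      (Q (f x t) * radialOp k x (f x t) (fx x t) (fxx x t)) (Ici 0) t := fun x hx t ht => by
    obtain ⟨-, -, h3, h4⟩ := hder x hx t ht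
    rw [h4] at h3
    refine h3.congr_deriv ?_
    rw [radialOp]
    push_cast
    ring
  have hLc : ∀ x ∈ Icc 1 β, ContinuousOn
      (fun t => radialOp k x (f x t) (fx x t) (fxx x t)) (Ici 0) := fun x hx => by
    have hm : MapsTo (fun t : ℝ => (x, t)) (Ici 0) (Icc 1 β ×ˢ Ici 0) := fun t ht => ⟨hx, ht⟩
    have h1 : ContinuousOn (fun t => f x t) (Ici 0) :=
      hf.cont.comp (f := fun t : ℝ => (x, t)) (by fun_prop) hm
    have h2 : ContinuousOn (fun t => fx x t) (Ici 0) :=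
      hcx.comp (f := fun t : ℝ => (x, t)) (by fun_prop) hm
    have h3 : ContinuousOn (fun t => fxx x t) (Ici 0) :=
      hcxx.comp (f := fun t : ℝ => (x, t)) (by fun_prop) hm
    unfold radialOp
    exact (h3.add ((continuousOn_const.mul h2).div_const x)).sub
      ((continuousOn_const.mul h1).div_const (x ^ 2))
  obtain ⟨C, hC⟩ : ∃ C, LipschitzOnWith C Q (Icc 1 α) :=
    hQ.smooth.exists_lipschitzOnWith (by simp) (convex_Icc _ _) isCompact_Icc
  have h1mem : (1 : ℝ) ∈ Icc 1 α := ⟨le_rfl, hα.le⟩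
  have hαmem : α ∈ Icc 1 α := ⟨hα.le, le_rfl⟩
  have hQα : ∀ y ∈ Icc 1 α, Q y ≤ C * (α - y) := fun y hy => by
    have h1 := hC.dist_le_mul y hy α hαmem
    rw [(hQ.zero_iff α hαmem).2 (Or.inr rfl), Real.dist_eq, Real.dist_eq, sub_zero,
      abs_sub_comm, abs_of_nonneg (sub_nonneg.2 hy.2)] at h1
    exact (le_abs_self _).trans h1
  have hQ1 : ∀ y ∈ Icc 1 α, Q y ≤ C * (y - 1) := fun y hy => by
    have h1 := hC.dist_le_mul y hy 1 h1mem
    rw [(hQ.zero_iff 1 h1mem).2 (Or.inl rfl), Real.dist_eq, Real.dist_eq, sub_zero,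
      abs_of_nonneg (sub_nonneg.2 hy.1)] at h1
    exact (le_abs_self _).trans h1
  have hQpos : ∀ y ∈ Ioo 1 α, 0 < Q y := fun y hy => by
    have hy' : y ∈ Icc 1 α := ⟨hy.1.le, hy.2.le⟩
    refine (hQ.nonneg y hy').lt_of_ne fun h => ?_
    rcases (hQ.zero_iff y hy').1 h.symm with h | h <;> linarith [hy.1, hy.2]
  have hneg_mem : ∀ y ∈ Icc (-α) (-1), -y ∈ Icc 1 α := fun y hy =>
    ⟨by linarith [hy.2], by linarith [hy.1]⟩
  have flow₁ : IsRadialFlow k β 1 α Q f fx fxx :=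
    { range := hf.range
      lt := fun x hx t ht => by
        have hx' : x ∈ Icc 1 β := ⟨hx.1.le, hx.2.le⟩
        -- `Q` is Lipschitz and vanishes at `α`, and strict initial monotonicity starts interior
        -- points below `α`.
        refine lt_of_deriv_eq_mul (hLc x hx') (hdt x hx')
          (fun t ht => hQ.nonneg _ (hf.range x hx' t ht))
          (fun t ht => hQα _ (hf.range x hx' t ht)) ?_ ht
        have := h0 hx' ⟨hβ.le, le_rfl⟩ hx.2
        simpa only [hf.right 0 self_mem_Ici] using this
      cont := hf.cont
      cont_x := hcx
      cont_xx := hcxx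
      deriv_x := fun x hx t ht => (hder x hx t ht).1
      deriv_xx := fun x hx t ht => (hder x hx t ht).2.1
      deriv_t := hdt
      coeff_cont := hQ.smooth.continuousOn
      coeff_pos := hQpos }
  have hop : ∀ x t, -(Q (f x t) * radialOp k x (f x t) (fx x t) (fxx x t)) =
      Q (- -f x t) * radialOp k x (-f x t) (-fx x t) (-fxx x t) := fun x t => by
    rw [neg_neg, radialOp, radialOp]
    ring
  have hdt' : ∀ x ∈ Icc 1 β, ∀ t ∈ Ici (0 : ℝ), HasDerivWithinAt (fun s => -f x s)
      (Q (- -f x t) * radialOp k x (-f x t) (-fx x t) (-fxx x t)) (Ici 0) t := fun x hx t ht =>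
    (hdt x hx t ht).neg.congr_deriv (hop x t)
  have flow₂ : IsRadialFlow k β (-α) (-1) (fun y => Q (-y)) (fun x t => -f x t)
      (fun x t => -fx x t) (fun x t => -fxx x t) :=
    { range := fun x hx t ht =>
        ⟨neg_le_neg (hf.range x hx t ht).2, neg_le_neg (hf.range x hx t ht).1⟩
      lt := fun x hx t ht => by
        have hx' : x ∈ Icc 1 β := ⟨hx.1.le, hx.2.le⟩
        refine lt_of_deriv_eq_mul (R := fun y => Q (-y)) (C := C)
          (ℓ := fun t => radialOp k x (-f x t) (-fx x t) (-fxx x t))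
          ((hLc x hx').neg.congr fun t _ => by
            simp only [radialOp, Pi.neg_apply]; ring) (hdt' x hx')
          (fun t ht => ?_) (fun t ht => ?_) ?_ ht
        · simpa using hQ.nonneg _ (hf.range x hx' t ht)
        · have := hQ1 _ (hf.range x hx' t ht)
          simp only [neg_neg]
          linarith
        · have := h0 ⟨le_rfl, hβ.le⟩ hx' hx.1
          simp only [hf.left 0 self_mem_Ici] at this
          linarith
      cont := hf.cont.neg
      cont_x := hcx.neg
      cont_xx := hcxx.neg
      deriv_x := fun x hx t ht => (hder x hx t ht).1.neg
      deriv_xx := fun x hx t ht => (hder x hx t ht).2.1.neg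
      deriv_t := hdt'
      coeff_cont := hQ.smooth.continuousOn.comp continuous_neg.continuousOn hneg_mem
      coeff_pos := fun y hy => hQpos (-y) ⟨by linarith [hy.2], by linarith [hy.1]⟩ }
  have hF1 : stationary k a b l 1 = 1 := hd.stationary_of_le hd.one_le
  have hFβ : stationary k a b l β = α := hd.stationary_right
  have barrier₁ : IsRadialBarrier k β 1 α f (stationary k a b l) (stationaryDeriv k a b l) :=
    { deriv := fun x hx => hd.hasDerivWithinAt hx
      cont_deriv := hd.continuous_deriv.continuousOn
      lower := fun x hx => (hd.mem_Icc hx).1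
      left := fun t ht => by rw [hf.left t ht, hF1]
      right := fun t ht => by rw [hf.right t ht, hFβ]
      weak := hd.isWeakSupersolution α }
  have barrier₂ : IsRadialBarrier k β (-α) (-1) (fun x t => -f x t)
      (fun x => -stationary k a b l x) (fun x => -stationaryDeriv k a b l x) :=
    { deriv := fun x hx => (hd.hasDerivWithinAt hx).neg
      cont_deriv := hd.continuous_deriv.neg.continuousOn
      lower := fun x hx => neg_le_neg (hd.mem_Icc hx).2
      left := fun t ht => by rw [hf.left t ht, hF1]
      right := fun t ht => by rw [hf.right t ht, hFβ]
      weak := hd.isWeakSupersolution_neg }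
  have hunif : ∀ ε > 0, ∃ δ > 0, ∀ x ∈ Icc 1 β, ∀ y ∈ Icc 1 β, |x - y| ≤ δ →
      |stationary k a b l x - stationary k a b l y| < ε := fun ε hε => by
    have huc : UniformContinuousOn (stationary k a b l) (Icc 1 β) :=
      isCompact_Icc.uniformContinuousOn_of_continuous fun x hx =>
        (hd.hasDerivWithinAt hx).continuousWithinAt
    obtain ⟨δ, hδ, hδ'⟩ := Metric.uniformContinuousOn_iff.1 huc ε hε
    exact ⟨δ / 2, by positivity, fun x hx y hy hxy => hδ' x hx y hy (by
      rw [Real.dist_eq]; linarith)⟩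
  rw [Metric.tendstoUniformlyOn_iff]
  intro ε hε
  obtain ⟨δ, hδ, hF⟩ := hunif (ε / 2 / 2) (by positivity)
  -- `f` increases to the right, so the window is `[x, x + δ]`: of an excess `ε/2`, at most `ε/4` is
  -- lost to the variation of `F`. It fits before `β` because `f ≤ α = F β`.
  obtain ⟨T₁, -, hT₁⟩ := flow₁.eventually_le_barrier barrier₁ hk hβ hα.le (half_pos hε) (by
    refine ⟨δ, hδ, fun t ht x hx hlt => ⟨x, hx.1, ?_, fun z hz => ?_⟩⟩
    · by_contra! hgt
      have h1 := abs_lt.1 (hF x hx β ⟨hβ.le, le_rfl⟩ (by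
        rw [abs_sub_comm, abs_of_nonneg (sub_nonneg.2 hx.2)]; linarith))
      linarith [(hf.range x hx t ht).2]
    · by_cases hzβ : z ≤ β
      · have hz' : z ∈ Icc 1 β := ⟨hx.1.trans hz.1, hzβ⟩
        have h1 := abs_lt.1 (hF x hx z hz' (by
          rw [abs_sub_comm, abs_of_nonneg (sub_nonneg.2 hz.1)]; linarith [hz.2]))
        have h2 := hmono t ht hx hz' hz.1
        simp only at h2
        linarith
      · have h1 := abs_lt.1 (hF x hx β ⟨hβ.le, le_rfl⟩ (by
          rw [abs_sub_comm, abs_of_nonneg (sub_nonneg.2 hx.2)]; linarith [hz.2]))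
        linarith [(hf.range x hx t ht).2])
  -- For `-f` the window lies to the left of `x`, and fits because `f ≥ 1 = F 1`.
  obtain ⟨T₂, -, hT₂⟩ := flow₂.eventually_le_barrier barrier₂ hk hβ (by linarith) (half_pos hε) (by
    refine ⟨δ, hδ, fun t ht x hx hlt => ?_⟩
    have hx1 : 1 ≤ x - δ := by
      by_contra! hgt
      have h1 := abs_lt.1 (hF x hx 1 ⟨le_rfl, hβ.le⟩ (by
        rw [abs_of_nonneg (sub_nonneg.2 hx.1)]; linarith))
      linarith [(hf.range x hx t ht).1]
    refine ⟨x - δ, hx1, by linarith [hx.2], fun z hz => ?_⟩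
    have hzx : z ≤ x := by linarith [hz.2]
    have hz' : z ∈ Icc 1 β := ⟨hx1.trans hz.1, hzx.trans hx.2⟩
    have h1 := abs_lt.1 (hF x hx z hz' (by
      rw [abs_of_nonneg (sub_nonneg.2 hzx)]; linarith [hz.1]))
    have h2 := hmono t ht hz' hx hzx
    simp only at h2
    linarith)
  filter_upwards [eventually_ge_atTop (max T₁ T₂)] with t ht x hx
  have h1 := hT₁ t ((le_max_left _ _).trans ht) x hx
  have h2 := hT₂ t ((le_max_right _ _).trans ht) x hx
  rw [Real.dist_eq, abs_lt]
  constructor <;> linarith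

/-! ### The ordinary differential equation -/

theorem solvesODE_radialSolution (k : ℕ) (a b : ℝ) {l β : ℝ} (hl : 0 < l) :
    SolvesODE (k + 1) l β (radialSolution k a b) := by
  refine ⟨radialSolutionDeriv k a b, fun x =>
    k * radialSolution k a b x / x ^ 2 - k * radialSolutionDeriv k a b x / x, fun x hx => ?_⟩
  have hx0 : x ≠ 0 := (hl.trans_le hx.1).ne'
  refine ⟨(hasDerivAt_radialSolution k a b hx0).hasDerivWithinAt,
    (hasDerivAt_radialSolutionDeriv k a b hx0).hasDerivWithinAt, ?_⟩
  push_cast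
  ring

/-- Every solution of the ODE has the form `a x + b / x^k`. -/
theorem SolvesODE.exists_eq_radialSolution {k : ℕ} {l β : ℝ} {h : ℝ → ℝ}
    (hh : SolvesODE (k + 1) l β h) (hl : 0 < l) :
    ∃ a b, ∀ x ∈ Icc l β, h x = radialSolution k a b x := by
  obtain ⟨h₁, h₂, hd⟩ := hh
  have hx0 : ∀ x ∈ Icc l β, x ≠ 0 := fun x hx => (hl.trans_le hx.1).ne'
  have hconst : ∀ u : ℝ → ℝ, (∀ x ∈ Icc l β, HasDerivWithinAt u 0 (Icc l β) x) →
      ∀ x ∈ Icc l β, u x = u l := fun u hu =>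
    constant_of_has_deriv_right_zero (fun x hx => (hu x hx).continuousWithinAt) fun x hx =>
      (hu x ⟨hx.1, hx.2.le⟩).mono_of_mem_nhdsWithin (Icc_mem_nhdsGE_of_mem hx)
  -- Two first integrals of the equation; on `a x + b/x^k` they take the values `(k+1) a` and `(k+1)
  -- b`.
  have hI := hconst (fun x => h₁ x + k * h x / x) fun x hx => by
    obtain ⟨d1, d2, he⟩ := hd x hx
    refine (d2.add ((d1.const_mul (k : ℝ)).div (hasDerivWithinAt_id x _) (hx0 x hx))).congr_deriv ?_
    rw [← he]
    have := hx0 x hx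
    push_cast
    simp only [id]
    field_simp
    ring
  have hJ := hconst (fun x => x ^ k * h x - x ^ (k + 1) * h₁ x) fun x hx => by
    obtain ⟨d1, d2, he⟩ := hd x hx
    refine (((hasDerivAt_pow_of_ne_zero k (hx0 x hx)).hasDerivWithinAt.mul d1).sub
      ((hasDerivAt_pow_of_ne_zero (k + 1) (hx0 x hx)).hasDerivWithinAt.mul d2)).congr_deriv ?_
    rw [show (0 : ℝ) = -x ^ (k + 1) * 0 by ring, ← he]
    have := hx0 x hx
    push_cast
    field_simp
    ring
  refine ⟨(h₁ l + k * h l / l) / (k + 1), (l ^ k * h l - l ^ (k + 1) * h₁ l) / (k + 1),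
    fun x hx => ?_⟩
  have h1 := hI x hx
  have h2 := hJ x hx
  rw [← h1, ← h2, radialSolution]
  have := hx0 x hx
  have hk : (k : ℝ) + 1 ≠ 0 := by positivity
  field_simp
  ring

/-- A solution vanishing at `β` is a multiple of `(x^(k+1) - β^(k+1)) / x^k`. -/
theorem radialSolution_of_right_eq_zero {k : ℕ} {a b β : ℝ} (hβ : 0 < β)
    (h : radialSolution k a b β = 0) {x : ℝ} (hx : 0 < x) :
    radialSolution k a b x = a * ((x ^ (k + 1) - β ^ (k + 1)) / x ^ k) := by
  have hb : b = -a * β ^ (k + 1) := by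
    rw [radialSolution] at h
    field_simp at h
    linear_combination h
  rw [radialSolution, hb]
  field_simp
  ring

theorem radialSolution_sub (k : ℕ) (a b a' b' x : ℝ) :
    radialSolution k (a - a') (b - b') x = radialSolution k a b x - radialSolution k a' b' x := by
  simp only [radialSolution]
  ring

theorem pow_sub_pow_div_neg {k : ℕ} {x β : ℝ} (hx : 0 < x) (hxβ : x < β) :
    (x ^ (k + 1) - β ^ (k + 1)) / x ^ k < 0 :=
  div_neg_of_neg_of_pos (sub_neg.2 (pow_lt_pow_left₀ hxβ hx.le k.succ_ne_zero)) (pow_pos hx k)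

/-- The difference vanishes at `β`, so it is a multiple of a function without zeros in `(0,β)`;
vanishing at `l` kills the factor. -/
theorem SolvesODE.eqOn {k : ℕ} {l β a b : ℝ} {h : ℝ → ℝ} (hh : SolvesODE (k + 1) l β h)
    (hl : 0 < l) (hlβ : l < β) (h1 : h l = radialSolution k a b l)
    (h2 : h β = radialSolution k a b β) : EqOn h (radialSolution k a b) (Icc l β) := by
  obtain ⟨a', b', he⟩ := hh.exists_eq_radialSolution hl
  have hβ : 0 < β := hl.trans hlβ
  have e : radialSolution k (a' - a) (b' - b) β = 0 := by
    rw [radialSolution_sub, ← he β ⟨hlβ.le, le_rfl⟩, h2, sub_self]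
  have el := radialSolution_of_right_eq_zero hβ e hl
  rw [radialSolution_sub, ← he l ⟨le_rfl, hlβ.le⟩, h1, sub_self] at el
  have ha : a' - a = 0 :=
    (mul_eq_zero.1 el.symm).resolve_right (pow_sub_pow_div_neg hl hlβ).ne
  intro x hx
  have ex := radialSolution_of_right_eq_zero hβ e (hl.trans_le hx.1)
  rw [radialSolution_sub, ha, zero_mul, ← he x hx] at ex
  linarith

/-! ### The contact point -/

/-- The solution with value `1` and slope `0` at `1`. -/
noncomputable def tangentSolution (k : ℕ) (s : ℝ) : ℝ := (k * s + 1 / s ^ k) / (k + 1)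

/-- The equation is invariant under dilations, so the solution tangent to `1` at `l` is a rescaling
of the one at `1`. -/
theorem radialSolution_tangent {k : ℕ} {l x : ℝ} (hl : 0 < l) (hx : 0 < x) :
    radialSolution k (k / ((k + 1) * l)) (l ^ k / (k + 1)) x = tangentSolution k (x / l) := by
  rw [radialSolution, tangentSolution, div_pow]
  have hk : (k : ℝ) + 1 ≠ 0 := by positivity
  field_simp

theorem radialSolutionDeriv_tangent {k : ℕ} {l x : ℝ} (hl : 0 < l) (hx : 0 < x) :
    radialSolutionDeriv k (k / ((k + 1) * l)) (l ^ k / (k + 1)) x =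
      k / ((k + 1) * l) * (1 - (l / x) ^ (k + 1)) := by
  rw [radialSolutionDeriv, div_pow]
  have hk : (k : ℝ) + 1 ≠ 0 := by positivity
  field_simp
  ring

/-- Strict Bernoulli inequality for `(1/s)^(k+1)`, multiplied by `s`. -/
theorem one_lt_tangentSolution {k : ℕ} (hk : 1 ≤ k) {s : ℝ} (hs : 0 < s) (hs1 : s < 1) :
    1 < tangentSolution k s := by
  have hk0 : (0 : ℝ) < k := by exact_mod_cast hk
  have hs' : 0 < 1 / s - 1 := by
    rw [sub_pos, lt_div_iff₀ hs]; linarith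
  have h := one_add_mul_self_lt_rpow_one_add (s := 1 / s - 1) (by linarith) hs'.ne'
    (p := (k : ℝ) + 1) (by linarith)
  rw [add_sub_cancel, show (k : ℝ) + 1 = ((k + 1 : ℕ) : ℝ) by push_cast; ring,
    Real.rpow_natCast] at h
  rw [tangentSolution, lt_div_iff₀ (by positivity), one_mul]
  have h' := mul_lt_mul_of_pos_right h hs
  have e : (1 / s) ^ (k + 1) * s = 1 / s ^ k := by
    rw [div_pow, one_pow]
    field_simp
    ring
  rw [e] at h'
  have e2 : (1 + ((k + 1 : ℕ) : ℝ) * (1 / s - 1)) * s = s + (k + 1) * (1 - s) := by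
    push_cast
    field_simp
  rw [e2] at h'
  linarith

/-- Below the critical slope there is a contact point inside `(1,β)`. -/
theorem exists_contact {k : ℕ} (hk : 1 ≤ k) {α β : ℝ} (hα : 1 < α) (hβ : 1 < β)
    (hlt : (α * β ^ k - 1) / (β ^ (k + 1) - 1) < k / (k + 1)) :
    ∃ l, 1 < l ∧ l < β ∧
      IsStationaryData k α β (k / ((k + 1) * l)) (l ^ k / (k + 1)) l := by
  have hk0 : (0 : ℝ) < k := by exact_mod_cast hk
  have hβ0 : 0 < β := by linarith
  have hpow : 0 < β ^ (k + 1) - 1 := sub_pos.2 (one_lt_pow₀ hβ (by omega))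
  -- This is the slope condition with denominators cleared; it gives the intermediate value `s` with
  -- `tangentSolution k s = α`, and the contact point is `β / s`.
  have hψβ : α < tangentSolution k β := by
    rw [div_lt_div_iff₀ hpow (by positivity)] at hlt
    rw [tangentSolution, lt_div_iff₀ (by positivity)]
    have hβk : 0 < β ^ k := by positivity
    have e : (k * β + 1 / β ^ k) = (k * β ^ (k + 1) + 1) / β ^ k := by
      field_simp
      ring
    rw [e, lt_div_iff₀ hβk]
    linarith
  have hψ1 : tangentSolution k 1 = 1 := by
    rw [tangentSolution]
    field_simp
    simp
  have hcont : ContinuousOn (tangentSolution k) (Icc 1 β) := by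
    have : ∀ s ∈ Icc 1 β, s ^ k ≠ 0 := fun s hs => pow_ne_zero k (by linarith [hs.1])
    unfold tangentSolution
    fun_prop (disch := first | assumption | positivity)
  obtain ⟨s, hs, hsα⟩ := intermediate_value_Ioo hβ.le hcont
    (show α ∈ Ioo (tangentSolution k 1) (tangentSolution k β) from ⟨by rwa [hψ1], hψβ⟩)
  have hs0 : 0 < s := by linarith [hs.1]
  have hl0 : 0 < β / s := by positivity
  have hl1 : 1 < β / s := by rw [lt_div_iff₀ hs0]; linarith [hs.2]
  have hlβ : β / s < β := div_lt_self hβ0 hs.1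
  refine ⟨β / s, hl1, hlβ, hl1.le, hlβ, ?_, ?_, fun x hx => ?_, Or.inr ?_⟩
  · rw [radialSolution_tangent hl0 hl0, div_self hl0.ne', hψ1]
  · rw [radialSolution_tangent hl0 hβ0, div_div_cancel₀ hβ0.ne', hsα]
  · have hx0 : 0 < x := hl0.trans_le hx.1
    rw [radialSolutionDeriv_tangent hl0 hx0]
    refine mul_nonneg (by positivity) (sub_nonneg.2 (pow_le_one₀ (by positivity) ?_))
    exact (div_le_one hx0).2 hx.1
  · rw [radialSolutionDeriv_tangent hl0 hl0, div_self hl0.ne']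
    simp

/-- The contact point is the least admissible point. -/
theorem IsStationaryData.isLeast {k : ℕ} (hk : 1 ≤ k) {α β l : ℝ}
    (h : IsStationaryData k α β (k / ((k + 1) * l)) (l ^ k / (k + 1)) l) :
    IsLeast (admissiblePoints (k + 1) α β) l := by
  set a : ℝ := k / ((k + 1) * l) with ha
  set b : ℝ := l ^ k / (k + 1) with hb
  have hl0 : 0 < l := by linarith [h.one_le]
  have hβ0 : 0 < β := hl0.trans h.lt
  refine ⟨⟨⟨h.one_le, h.lt.le⟩, radialSolution k a b, solvesODE_radialSolution k a b hl0, h.left,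
    h.right, fun x hx => ?_⟩, fun l' hl' => ?_⟩
  · rw [← IsStationaryData.stationary_of_ge hx.1]
    exact (h.mem_Icc ⟨h.one_le.trans hx.1, hx.2⟩).1
  · obtain ⟨hl'I, g, hg, hg1, hgβ, hge⟩ := hl'
    by_contra! hlt
    have hl'0 : 0 < l' := by linarith [hl'I.1]
    obtain ⟨a', b', he⟩ := hg.exists_eq_radialSolution hl'0
    have e : radialSolution k (a - a') (b - b') β = 0 := by
      rw [radialSolution_sub, ← he β ⟨hl'I.2, le_rfl⟩, hgβ, h.right, sub_self]
    have e1 := radialSolution_of_right_eq_zero hβ0 e hl'0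
    have e2 := radialSolution_of_right_eq_zero hβ0 e hl0
    rw [radialSolution_sub, ← he l' ⟨le_rfl, hl'I.2⟩, hg1, radialSolution_tangent hl0 hl'0] at e1
    rw [radialSolution_sub, ← he l ⟨hlt.le, h.lt.le⟩, h.left] at e2
    have p1 := one_lt_tangentSolution hk (div_pos hl'0 hl0) ((div_lt_one hl0).2 hlt)
    have p2 := hge l ⟨hlt.le, h.lt.le⟩
    have n1 := pow_sub_pow_div_neg (k := k) hl'0 (hlt.trans h.lt)
    have n2 := pow_sub_pow_div_neg (k := k) hl0 h.lt
    -- The tangent solution minus `g` vanishes at `β`, so it has one sign to the left of `β`. Yet it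
    -- is positive at `l'`, where the tangent solution exceeds `1 = g`, and nonpositive at `l`,
    -- where `g ≥ 1`.
    rcases le_or_gt 0 (a - a') with hs | hs
    · linarith [mul_nonpos_of_nonneg_of_nonpos hs n1.le]
    · linarith [mul_pos_of_neg_of_neg hs n2]

/-- At or above the critical slope the stationary state is `odeProfile`. -/
theorem isStationaryData_odeProfile {k : ℕ} {α β : ℝ} (hβ : 1 < β)
    (hge : (k : ℝ) / (k + 1) ≤ (α * β ^ k - 1) / (β ^ (k + 1) - 1)) :
    IsStationaryData k α β ((α * β ^ k - 1) / (β ^ (k + 1) - 1))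
      ((β ^ (k + 1) - α * β ^ k) / (β ^ (k + 1) - 1)) 1 := by
  have hβ0 : 0 < β := by linarith
  have hpow : 0 < β ^ (k + 1) - 1 := sub_pos.2 (one_lt_pow₀ hβ (by omega))
  set a : ℝ := (α * β ^ k - 1) / (β ^ (k + 1) - 1) with ha
  have hb : (β ^ (k + 1) - α * β ^ k) / (β ^ (k + 1) - 1) = 1 - a := by
    rw [ha]
    field_simp
    ring
  rw [hb]
  refine ⟨le_rfl, hβ, ?_, ?_, fun x hx => ?_, Or.inl rfl⟩
  · simp [radialSolution]
  · rw [radialSolution, ha]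
    field_simp
    ring
  · rw [radialSolutionDeriv, sub_nonneg]
    have hx1 : 1 ≤ x ^ (k + 1) := one_le_pow₀ hx.1
    have ha0 : 0 ≤ a := le_trans (by positivity) hge
    -- For `b = 1 - a ≤ 0` the slope is at least `a`; for `b ≥ 0` it is smallest at `x = 1`, where
    -- it equals `(k+1) a - k ≥ 0`.
    rcases le_total (1 - a) 0 with h | h
    · refine le_trans (div_nonpos_of_nonpos_of_nonneg ?_ (by linarith)) ha0
      exact mul_nonpos_of_nonneg_of_nonpos (Nat.cast_nonneg k) h
    · refine (div_le_self (by positivity) hx1).trans ?_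
      rw [div_le_iff₀ (by positivity)] at hge
      linarith

theorem theorem2 (n : ℕ) (hn : 2 ≤ n) (α β : ℝ) (hα : 1 < α) (hβ : 1 < β) :
    ∃ F : ℝ → ℝ,
      -- every solution converges uniformly to `F`, whatever the coefficient and the initial value
      (∀ Q : ℝ → ℝ, IsDegenerateCoefficient α Q →
        ∀ f : ℝ → ℝ → ℝ, IsClassicalSolution n α β Q f →
          StrictMonoOn (fun x => f x 0) (Icc 1 β) →
          TendstoUniformlyOn (fun t x => f x t) F atTop (Icc 1 β)) ∧
      (β < α → EqOn F (odeProfile n α β) (Icc 1 β)) ∧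
      (α < β → ((n : ℝ) - 1) / n < (α * β ^ (n - 1) - 1) / (β ^ n - 1) →
        EqOn F (odeProfile n α β) (Icc 1 β)) ∧
      (α < β → (α * β ^ (n - 1) - 1) / (β ^ n - 1) = ((n : ℝ) - 1) / n →
        EqOn F (odeProfile n α β) (Icc 1 β)) ∧
      (α < β → (α * β ^ (n - 1) - 1) / (β ^ n - 1) < ((n : ℝ) - 1) / n →
        ∃ (l : ℝ) (g : ℝ → ℝ),
          IsLeast (admissiblePoints n α β) l ∧ 1 < l ∧ l < β ∧
          SolvesODE n l β g ∧ g l = 1 ∧ g β = α ∧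
          (∀ h : ℝ → ℝ, SolvesODE n l β h → h l = 1 → h β = α → EqOn h g (Icc l β)) ∧
          HasDerivWithinAt g 0 (Icc l β) l ∧
          (∀ x ∈ Icc 1 l, F x = 1) ∧ EqOn F g (Icc l β)) := by
  obtain ⟨k, rfl⟩ : ∃ k, n = k + 1 := ⟨n - 1, by omega⟩
  have hk : 1 ≤ k := by omega
  simp only [Nat.add_sub_cancel, Nat.cast_add, Nat.cast_one, add_sub_cancel_right]
  rcases lt_or_ge ((α * β ^ k - 1) / (β ^ (k + 1) - 1)) ((k : ℝ) / (k + 1)) with hlt | hge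
  · obtain ⟨l, hl1, hlβ, hd⟩ := exists_contact hk hα hβ hlt
    have hl0 : 0 < l := by linarith
    -- If `β ≤ α` the coefficient `a` is at least `1`, hence above `k/(k+1)`; so the clause for `β <
    -- α` is vacuous in this branch.
    have hαβ : α < β := by
      by_contra! hle
      have hpow : 0 < β ^ (k + 1) - 1 := sub_pos.2 (one_lt_pow₀ hβ (by omega))
      have h1 : (1 : ℝ) ≤ (α * β ^ k - 1) / (β ^ (k + 1) - 1) := by
        rw [one_le_div hpow, pow_succ']
        have := mul_le_mul_of_nonneg_right hle (by positivity : 0 ≤ β ^ k)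
        linarith
      have h2 : (k : ℝ) / (k + 1) ≤ 1 := by
        rw [div_le_one (by positivity)]; linarith
      linarith
    refine ⟨_, fun Q hQ f hf h0 => hf.tendstoUniformlyOn hk hα hQ h0 hd,
      fun h => absurd h hαβ.not_gt, fun _ h => absurd h hlt.not_gt, fun _ h => absurd h hlt.ne,
      fun _ _ => ⟨l, _, hd.isLeast hk, hl1, hlβ, solvesODE_radialSolution k _ _ hl0, hd.left,
        hd.right, fun h hh h1 h2 => hh.eqOn hl0 hlβ (h1.trans hd.left.symm) (h2.trans hd.right.symm),
        ?_, fun x hx => hd.stationary_of_le hx.2,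
        fun x hx => IsStationaryData.stationary_of_ge hx.1⟩⟩
    have hder := hasDerivAt_radialSolution k (k / ((k + 1) * l)) (l ^ k / (k + 1)) hl0.ne'
    rw [hd.junction.resolve_left hl1.ne'] at hder
    exact hder.hasDerivWithinAt
  · have hd := isStationaryData_odeProfile hβ hge
    have hF : EqOn (stationary k ((α * β ^ k - 1) / (β ^ (k + 1) - 1))
        ((β ^ (k + 1) - α * β ^ k) / (β ^ (k + 1) - 1)) 1) (odeProfile (k + 1) α β) (Icc 1 β) :=
      fun x hx => IsStationaryData.stationary_of_ge hx.1
    exact ⟨_, fun Q hQ f hf h0 => hf.tendstoUniformlyOn hk hα hQ h0 hd, fun _ => hF,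
      fun _ _ => hF, fun _ _ => hF, fun _ h => absurd h hge.not_gt⟩
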